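/- All objects are holomorphic and considered locally in $\mathbb C^2$ with coordinates $(x,y)$. A planar $3$-web on an open set $\Omega\subset\mathbb C^2$ consists of three foliations of $\Omega$ by curves, any two of which are transverse at every point; it is linear if all the leaves are (pieces of) straight lines. A morphism of a linear $3$-web is a biholomorphic map $\varphi:U\to\varphi(U)\subset\mathbb C^2$, $U\subset\Omega$ open, that maps the web to a linear $3$-web on $\varphi(U)$; it is projective if it is the restriction to $U$ of a projective transformation of $\mathbb P^2(\mathbb C)\supset\mathbb C^2$. Let $\mathcal W$ be a linear $3$-web on an open set $\Omega\subset\mathbb C^2$, let $V_i=\partial_x+\lambda_i\partial_y$, $i=1,2,3$, be vector fields on $\Omega$ tangent to the leaves of its three foliations, and let $p\in\Omega$. Then the following two conditions are equivalent. (a) $\mathcal W$ admits a non-projective morphism near $p$, i.e. a non-projective morphism defined on some connected open set $U$ with $p\in U\subset\Omega$. (b) There are a connected open set $U$ with $p\in U\subset\Omega$ and holomorphic functions $K,L,M,N$ on $U$, not all four identically zero, that satisfy on $U$ the (Tresse) system $$2K_{xy}+M_{yy}+N_{xx}-6KK_y+2ML_x+LM_x+3NM_y-3KN_x+3MN_y=0,$$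 $$K_{yy}+L_{xx}+2N_{xy}+3LK_x-3NK_y+3KL_x+ML_y+2LM_y-6NN_x=0$$ and the relations $$L\lambda_i^3-3N\lambda_i^2+3K\lambda_i-M=0,\qquad i=1,2,3.$$ -/

import Mathlib

open Topology

/-- The complex plane `ℂ²` with its coordinates `(x, y)`. -/
abbrev C2 : Type := ℂ × ℂ

/-- The partial derivative `f_x`. -/
noncomputable def pdx (f : C2 → ℂ) : C2 → ℂ := fun p => fderiv ℂ f p (1, 0)

/-- The partial derivative `f_y`. -/
noncomputable def pdy (f : C2 → ℂ) : C2 → ℂ := fun p => fderiv ℂ f p (0, 1)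

/-- `F` is (the field of tangent lines of) a holomorphic foliation by curves on the set `U`: near
each point of `U` the line `F q` is spanned by the value at `q` of a holomorphic vector field
without zeros. (In dimension two every holomorphic field of directions is tangent to a unique
foliation by curves, so a foliation is the same thing as its field of tangent lines.) -/
def IsFoliationOn (F : C2 → Submodule ℂ C2) (U : Set C2) : Prop :=
  ∀ p ∈ U, ∃ X : C2 → C2, AnalyticAt ℂ X p ∧
    ∀ᶠ q in 𝓝 p, X q ≠ 0 ∧ F q = Submodule.span ℂ {X q}

/-- `γ` is, near the parameter value `t₀`, a regular parametrization of a piece of a leaf of the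
foliation with tangent lines `F`. -/
def IsLeafCurveAt (F : C2 → Submodule ℂ C2) (γ : ℂ → C2) (t₀ : ℂ) : Prop :=
  ∀ᶠ t in 𝓝 t₀, ∃ w ∈ F (γ t), w ≠ 0 ∧ HasDerivAt γ w t

/-- A planar `d`-web on `U`: `d` holomorphic foliations by curves, in general position, that is,
any two of them are transverse at each point of `U`. Here `tangent i p` is the tangent line
at `p` of the leaf of the `i`-th foliation through `p`. -/
structure PlanarWeb (d : ℕ) (U : Set C2) where
  tangent : Fin d → C2 → Submodule ℂ C2
  foliation : ∀ i, IsFoliationOn (tangent i) U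
  transverse : ∀ p ∈ U, ∀ i j, i ≠ j → tangent i p ≠ tangent j p

/-- The web is linear: the leaves of all its foliations are rectilinear, i.e. near each point `p`
of `U` the leaf through `p` is (parametrized as) a piece of an affine line. -/
def PlanarWeb.IsLinear {d : ℕ} {U : Set C2} (W : PlanarWeb d U) : Prop :=
  ∀ i, ∀ p ∈ U, ∃ v : C2, IsLeafCurveAt (W.tangent i) (fun t : ℂ => p + t • v) 0

/-- `φ` is a biholomorphic map from the open set `U` onto its image. -/
structure IsBiholomorphicOn (φ : C2 → C2) (U : Set C2) : Prop where
  analytic : AnalyticOnNhd ℂ φ U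
  injOn : Set.InjOn φ U
  invertible : ∀ p ∈ U, (fderiv ℂ φ p).IsInvertible

/-- `φ`, defined on `U ⊆ Ω`, maps the web `W` to a linear web: it is a diffeomorphism of `U` onto
its image, and there is a linear web on the image to whose leaves `φ` maps the leaves of `W`. -/
def PlanarWeb.IsMorphismOn {d : ℕ} {Ω : Set C2} (W : PlanarWeb d Ω) (φ : C2 → C2)
    (U : Set C2) : Prop :=
  IsBiholomorphicOn φ U ∧ ∃ W' : PlanarWeb d (φ '' U), W'.IsLinear ∧
    ∀ i, ∀ p ∈ U, W'.tangent i (φ p) = (W.tangent i p).map (fderiv ℂ φ p).toLinearMap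

/-- `φ` is, on `U`, a projective transformation in the affine chart `(x, y) ↦ [x : y : 1]`. -/
def IsProjectiveOn (φ : C2 → C2) (U : Set C2) : Prop :=
  ∃ g : GL (Fin 3) ℂ, ∀ p ∈ U, ∃ c : ℂ, c ≠ 0 ∧
    g.val.mulVec ![p.1, p.2, 1] = c • ![(φ p).1, (φ p).2, 1]

/-- The Tresse compatibility system for `(K, L, M, N)` on `U`. -/
def TresseSystem (K L M N : C2 → ℂ) (U : Set C2) : Prop :=
  ∀ p ∈ U,
    2 * pdy (pdx K) p + pdy (pdy M) p + pdx (pdx N) p - 6 * K p * pdy K p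
        + 2 * M p * pdx L p + L p * pdx M p + 3 * N p * pdy M p
        - 3 * K p * pdx N p + 3 * M p * pdy N p = 0 ∧
    pdy (pdy K) p + pdx (pdx L) p + 2 * pdy (pdx N) p + 3 * L p * pdx K p
        - 3 * N p * pdy K p + 3 * K p * pdx L p + M p * pdy L p
        + 2 * L p * pdy M p - 6 * N p * pdx N p = 0

/-!
Write a curve as `y = y(x)` and `m = y'`. Pulling the straight lines of the target plane back by a
biholomorphic map `φ = (u, v)` gives the solutions of
`y'' = L m ^ 3 - 3 N m ^ 2 + 3 K m - M`, where `K, L, M, N` are the projectively invariant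
combinations of the Christoffel symbols `A, …, F` of the pulled back flat affine connection, i.e. of
the functions with `s_xx = A s_x + B s_y`, `s_xy = C s_x + D s_y`, `s_yy = E s_x + F s_y` for
`s = u, v`. The Tresse system says that this second order equation is linearizable. For a linear
web the leaves have `m' = 0`, so `φ` keeps them straight iff the slopes `λ_i` are roots of the cubic
`L m ^ 3 - 3 N m ^ 2 + 3 K m - M`, and `φ` is projective iff `K = L = M = N = 0`.

From a morphism to the system: the compatibility conditions of the equations for `u` and `v` are
flatness and vanishing torsion of the connection (`flatTorsionFreeAt_of_christoffel`), and the
Tresse system is a combination of these and of their first derivatives (`tresse_of_flat`). Linearity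
of the image web, differentiated along a leaf, is the cubic relation
(`christoffel_relation_of_linear_image`). If `K, L, M, N` vanish identically, then there is a
factor `c` with `c`, `c u`, `c v` affine, and `φ` is projective (`isProjectiveOn_of_christoffel`).

From the system to a morphism: the Tresse system is exactly the integrability condition of a linear
system of rank three for the `1`-jet `(s, s_x, s_y)` of a function `s` (`coeff_integrability`). An
integrable linear system has solutions with any initial value (`exists_flat_section`, a holomorphic
Frobenius theorem for linear systems: the system is solved along rays by inverting `1 - T`, with `T`
a Volterra operator depending analytically on the ray, and flatness gives the full system). For
three independent solutions `s₀, s₁, s₂`, the map `(s₁ / s₀, s₂ / s₀)` has the prescribed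
`K, L, M, N` (`exists_flattening`); along a line whose slope satisfies the cubic
relation, the velocity of the image curve keeps its direction, so that the image is again a line
(`isLeafCurveAt_image_line`). If that map were projective, `K, L, M, N` would vanish near `p`
(`eq_of_isProjectiveOn`), hence everywhere by the identity theorem.
-/

/-! ### Calculus of the partial derivatives `pdx` and `pdy` -/

theorem fderiv_apply_eq_pd (f : C2 → ℂ) (p v : C2) :
    fderiv ℂ f p v = v.1 * pdx f p + v.2 * pdy f p := by
  have hv : v = v.1 • ((1 : ℂ), (0 : ℂ)) + v.2 • ((0 : ℂ), (1 : ℂ)) := by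
    ext <;> simp
  conv_lhs => rw [hv]
  rw [map_add, map_smul, map_smul]
  rfl

@[fun_prop]
theorem AnalyticAt.pdx {f : C2 → ℂ} {p : C2} (hf : AnalyticAt ℂ f p) :
    AnalyticAt ℂ (pdx f) p :=
  ((ContinuousLinearMap.apply ℂ ℂ ((1 : ℂ), (0 : ℂ))).analyticAt _).comp hf.fderiv

@[fun_prop]
theorem AnalyticAt.pdy {f : C2 → ℂ} {p : C2} (hf : AnalyticAt ℂ f p) :
    AnalyticAt ℂ (pdy f) p :=
  ((ContinuousLinearMap.apply ℂ ℂ ((0 : ℂ), (1 : ℂ))).analyticAt _).comp hf.fderiv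

theorem Filter.EventuallyEq.pdx {f g : C2 → ℂ} {p : C2} (h : f =ᶠ[𝓝 p] g) :
    pdx f =ᶠ[𝓝 p] pdx g := by
  filter_upwards [h.fderiv (𝕜 := ℂ)] with q hq
  simp only [_root_.pdx, hq]

theorem Filter.EventuallyEq.pdy {f g : C2 → ℂ} {p : C2} (h : f =ᶠ[𝓝 p] g) :
    pdy f =ᶠ[𝓝 p] pdy g := by
  filter_upwards [h.fderiv (𝕜 := ℂ)] with q hq
  simp only [_root_.pdy, hq]

section Rules

variable {f g : C2 → ℂ} {p : C2}

@[simp] theorem pdx_const (c : ℂ) : pdx (fun _ => c) p = 0 := by simp [pdx]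

@[simp] theorem pdy_const (c : ℂ) : pdy (fun _ => c) p = 0 := by simp [pdy]

@[simp] theorem pdx_fst : pdx (fun q => q.1) p = 1 := by
  simp [pdx, fderiv_fst]

@[simp] theorem pdy_fst : pdy (fun q => q.1) p = 0 := by
  simp [pdy, fderiv_fst]

@[simp] theorem pdx_snd : pdx (fun q => q.2) p = 0 := by
  simp [pdx, fderiv_snd]

@[simp] theorem pdy_snd : pdy (fun q => q.2) p = 1 := by
  simp [pdy, fderiv_snd]

theorem pdx_add (hf : AnalyticAt ℂ f p) (hg : AnalyticAt ℂ g p) :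
    pdx (fun q => f q + g q) p = pdx f p + pdx g p := by
  simp [pdx, fderiv_fun_add hf.differentiableAt hg.differentiableAt]

theorem pdy_add (hf : AnalyticAt ℂ f p) (hg : AnalyticAt ℂ g p) :
    pdy (fun q => f q + g q) p = pdy f p + pdy g p := by
  simp [pdy, fderiv_fun_add hf.differentiableAt hg.differentiableAt]

theorem pdx_sub (hf : AnalyticAt ℂ f p) (hg : AnalyticAt ℂ g p) :
    pdx (fun q => f q - g q) p = pdx f p - pdx g p := by
  simp [pdx, fderiv_fun_sub hf.differentiableAt hg.differentiableAt]

theorem pdy_sub (hf : AnalyticAt ℂ f p) (hg : AnalyticAt ℂ g p) :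
    pdy (fun q => f q - g q) p = pdy f p - pdy g p := by
  simp [pdy, fderiv_fun_sub hf.differentiableAt hg.differentiableAt]

theorem pdx_neg : pdx (fun q => - f q) p = - pdx f p := by
  simp [pdx, fderiv_fun_neg]

theorem pdy_neg : pdy (fun q => - f q) p = - pdy f p := by
  simp [pdy, fderiv_fun_neg]

theorem pdx_mul (hf : AnalyticAt ℂ f p) (hg : AnalyticAt ℂ g p) :
    pdx (fun q => f q * g q) p = pdx f p * g p + f p * pdx g p := by
  simp [pdx, fderiv_fun_mul hf.differentiableAt hg.differentiableAt]
  ring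

theorem pdy_mul (hf : AnalyticAt ℂ f p) (hg : AnalyticAt ℂ g p) :
    pdy (fun q => f q * g q) p = pdy f p * g p + f p * pdy g p := by
  simp [pdy, fderiv_fun_mul hf.differentiableAt hg.differentiableAt]
  ring

theorem pdx_pdy_comm (hf : AnalyticAt ℂ f p) : pdx (pdy f) p = pdy (pdx f) p := by
  have h1 : DifferentiableAt ℂ (fderiv ℂ f) p := hf.fderiv.differentiableAt
  have hx (v w : C2) : fderiv ℂ (fun q => fderiv ℂ f q v) p w = fderiv ℂ (fderiv ℂ f) p w v := by
    rw [fderiv_clm_apply h1 (differentiableAt_const v)]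
    simp
  have h2 := (hf.contDiffAt (n := ⊤)).isSymmSndFDerivAt_of_omega
  change fderiv ℂ (fun q => fderiv ℂ f q (0, 1)) p (1, 0)
    = fderiv ℂ (fun q => fderiv ℂ f q (1, 0)) p (0, 1)
  rw [hx, hx]
  exact h2 _ _

theorem pdx_pdx_mul (hf : AnalyticAt ℂ f p) (hg : AnalyticAt ℂ g p) :
    pdx (pdx fun q => f q * g q) p
      = pdx (pdx f) p * g p + 2 * (pdx f p * pdx g p) + f p * pdx (pdx g) p := by
  have h : pdx (fun q => f q * g q) =ᶠ[𝓝 p] fun q => pdx f q * g q + f q * pdx g q := by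
    filter_upwards [hf.eventually_analyticAt, hg.eventually_analyticAt] with q h1 h2
    exact pdx_mul h1 h2
  rw [h.pdx.self_of_nhds]
  simp (disch := fun_prop) only [pdx_add, pdx_mul]
  ring

theorem pdy_pdx_mul (hf : AnalyticAt ℂ f p) (hg : AnalyticAt ℂ g p) :
    pdy (pdx fun q => f q * g q) p
      = pdy (pdx f) p * g p + pdx f p * pdy g p + pdy f p * pdx g p
        + f p * pdy (pdx g) p := by
  have h : pdx (fun q => f q * g q) =ᶠ[𝓝 p] fun q => pdx f q * g q + f q * pdx g q := by
    filter_upwards [hf.eventually_analyticAt, hg.eventually_analyticAt] with q h1 h2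
    exact pdx_mul h1 h2
  rw [h.pdy.self_of_nhds]
  simp (disch := fun_prop) only [pdy_add, pdy_mul]
  ring

theorem pdy_pdy_mul (hf : AnalyticAt ℂ f p) (hg : AnalyticAt ℂ g p) :
    pdy (pdy fun q => f q * g q) p
      = pdy (pdy f) p * g p + 2 * (pdy f p * pdy g p) + f p * pdy (pdy g) p := by
  have h : pdy (fun q => f q * g q) =ᶠ[𝓝 p] fun q => pdy f q * g q + f q * pdy g q := by
    filter_upwards [hf.eventually_analyticAt, hg.eventually_analyticAt] with q h1 h2
    exact pdy_mul h1 h2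
  rw [h.pdy.self_of_nhds]
  simp (disch := fun_prop) only [pdy_add, pdy_mul]
  ring

end Rules

theorem analyticAt_affine (α β γ : ℂ) (p : C2) :
    AnalyticAt ℂ (fun q : C2 => α * q.1 + β * q.2 + γ) p := by
  have h1 : AnalyticAt ℂ (fun q : C2 => q.1) p := analyticAt_fst
  have h2 : AnalyticAt ℂ (fun q : C2 => q.2) p := analyticAt_snd
  fun_prop

theorem pdx_affine (α β γ : ℂ) :
    pdx (fun q : C2 => α * q.1 + β * q.2 + γ) = fun _ => α := by
  funext p
  have h1 : AnalyticAt ℂ (fun q : C2 => q.1) p := analyticAt_fst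
  have h2 : AnalyticAt ℂ (fun q : C2 => q.2) p := analyticAt_snd
  simp (disch := fun_prop) [pdx_add, pdx_mul]

theorem pdy_affine (α β γ : ℂ) :
    pdy (fun q : C2 => α * q.1 + β * q.2 + γ) = fun _ => β := by
  funext p
  have h1 : AnalyticAt ℂ (fun q : C2 => q.1) p := analyticAt_fst
  have h2 : AnalyticAt ℂ (fun q : C2 => q.2) p := analyticAt_snd
  simp (disch := fun_prop) [pdy_add, pdy_mul]

theorem eventually_const_of_pd_eq_zero {f : C2 → ℂ} {p : C2} (hf : AnalyticAt ℂ f p)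
    (hx : ∀ᶠ q in 𝓝 p, pdx f q = 0) (hy : ∀ᶠ q in 𝓝 p, pdy f q = 0) :
    ∀ᶠ q in 𝓝 p, f q = f p := by
  obtain ⟨ε, hε, hb⟩ := Metric.eventually_nhds_iff_ball.1
    (hx.and (hy.and hf.eventually_analyticAt))
  refine Metric.eventually_nhds_iff_ball.2 ⟨ε, hε, fun q hq => ?_⟩
  refine Metric.isOpen_ball.is_const_of_fderiv_eq_zero (𝕜 := ℂ)
    (convex_ball p ε).isPreconnected
    (fun r hr => (hb r hr).2.2.differentiableAt.differentiableWithinAt) (fun r hr => ?_) hq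
    (Metric.mem_ball_self hε)
  ext1 <;> ext <;> simp [fderiv_apply_eq_pd, (hb r hr).1, (hb r hr).2.1]

theorem eventually_affine_of_second_pd_eq_zero {f : C2 → ℂ} {p : C2} (hf : AnalyticAt ℂ f p)
    (hxx : ∀ᶠ q in 𝓝 p, pdx (pdx f) q = 0) (hxy : ∀ᶠ q in 𝓝 p, pdy (pdx f) q = 0)
    (hyy : ∀ᶠ q in 𝓝 p, pdy (pdy f) q = 0) :
    ∃ α β γ : ℂ, ∀ᶠ q in 𝓝 p, f q = α * q.1 + β * q.2 + γ := by
  have hx := eventually_const_of_pd_eq_zero hf.pdx hxx hxy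
  have hy := eventually_const_of_pd_eq_zero hf.pdy
    (by filter_upwards [hxy, hf.eventually_analyticAt] with q h1 h2
        rw [pdx_pdy_comm h2, h1]) hyy
  have ha := analyticAt_affine (pdx f p) (pdy f p) 0
  have h := eventually_const_of_pd_eq_zero (hf.fun_sub (ha p))
    (by filter_upwards [hx, hf.eventually_analyticAt] with q h1 h2
        rw [pdx_sub h2 (ha q), pdx_affine, h1, sub_self])
    (by filter_upwards [hy, hf.eventually_analyticAt] with q h1 h2
        rw [pdy_sub h2 (ha q), pdy_affine, h1, sub_self])
  refine ⟨pdx f p, pdy f p, f p - (pdx f p * p.1 + pdy f p * p.2), ?_⟩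
  filter_upwards [h] with q hq
  linear_combination hq

/-! ### Integrable linear systems of partial differential equations -/

theorem analyticAt_clm_apply {V E F : Type*} [NormedAddCommGroup V] [NormedSpace ℂ V]
    [NormedAddCommGroup E] [NormedSpace ℂ E] [NormedAddCommGroup F] [NormedSpace ℂ F]
    {B : V → E →L[ℂ] F} {g : V → E} {z : V} (hB : AnalyticAt ℂ B z) (hg : AnalyticAt ℂ g z) :
    AnalyticAt ℂ (fun t => B t (g t)) z :=
  ((ContinuousLinearMap.id ℂ (E →L[ℂ] F)).analyticAt_bilinear (B z, g z)).comp₂ hB hg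

section LinearODE

variable {E : Type*} [NormedAddCommGroup E] [NormedSpace ℂ E]

/-- Uniqueness for a linear ordinary differential equation in a complex variable: differentiation
lowers a finite order of vanishing, while applying `B t` does not. -/
theorem eventually_eq_zero_of_linear_ode [CompleteSpace E] {D : ℂ → E} {B : ℂ → E →L[ℂ] E} {t₀ : ℂ}
    (hD : AnalyticAt ℂ D t₀) (hB : AnalyticAt ℂ B t₀) (h0 : D t₀ = 0)
    (h : ∀ᶠ t in 𝓝 t₀, deriv D t = B t (D t)) : ∀ᶠ t in 𝓝 t₀, D t = 0 := by
  have key := hD.analyticOrderAt_deriv_add_one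
  simp only [h0, sub_zero] at key
  by_contra hne
  have hfin : analyticOrderAt D t₀ ≠ ⊤ := fun h => hne (analyticOrderAt_eq_top.1 h)
  obtain ⟨n, hn⟩ := ENat.ne_top_iff_exists.1 hfin
  obtain ⟨g, hg, hDg⟩ := (natCast_le_analyticOrderAt hD).1 hn.le
  have hle : (n : ℕ∞) ≤ analyticOrderAt (deriv D) t₀ := by
    refine (natCast_le_analyticOrderAt hD.deriv).2 ⟨fun t => B t (g t),
      analyticAt_clm_apply hB hg, ?_⟩
    filter_upwards [h, hDg] with t h1 h2
    rw [h1, h2, map_smul]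
  rw [← hn] at key
  have h3 : (n : ℕ∞) + 1 ≤ n := key ▸ add_le_add_left hle 1
  exact absurd h3 (by exact_mod_cast Nat.not_succ_le_self n)

/-- The equation says that `t ↦ t • R (p + t • z)` solves a linear ordinary differential equation
with initial value `0`. -/
theorem eventually_eq_zero_of_radial [CompleteSpace E] {R : C2 → E} {P Q : C2 → E →L[ℂ] E} {p : C2}
    (hR : AnalyticAt ℂ R p) (hP : AnalyticAt ℂ P p) (hQ : AnalyticAt ℂ Q p)
    (h : ∀ᶠ q in 𝓝 p, fderiv ℂ R q (q - p)
      = - R q + ((q - p).1 • P q + (q - p).2 • Q q) (R q)) : ∀ᶠ q in 𝓝 p, R q = 0 := by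
  obtain ⟨ε, hε, hball⟩ := Metric.eventually_nhds_iff_ball.1
    (h.and (hR.eventually_analyticAt))
  refine Metric.eventually_nhds_iff_ball.2 ⟨ε, hε, fun q hq => ?_⟩
  set γ : ℂ → C2 := fun t => p + t • (q - p) with hγ
  have hγa (t : ℂ) : AnalyticAt ℂ γ t := by fun_prop
  have hγ0 : γ 0 = p := by simp [hγ]
  have hγ1 : γ 1 = q := by simp [hγ]
  have hconv : Convex ℝ (γ ⁻¹' Metric.ball p ε) := by
    have : γ ⁻¹' Metric.ball p ε = (fun t : ℂ => t • (q - p)) ⁻¹' Metric.ball 0 ε := by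
      ext t; simp [hγ]
    rw [this]
    exact (convex_ball (0 : C2) ε).is_linear_preimage
      ⟨fun x y => by simp [add_smul], fun c x => by simp [smul_smul, ← Complex.coe_smul]⟩
  have hDa : AnalyticOnNhd ℂ (fun t => t • R (γ t)) (γ ⁻¹' Metric.ball p ε) := by
    intro t ht
    have := (hball _ ht).2
    exact analyticAt_id.smul (this.comp (hγa t))
  have hd (t : ℂ) : HasDerivAt γ (q - p) t := by
    simpa [hγ] using ((hasDerivAt_id t).smul_const (q - p)).const_add p
  have h0 : ∀ᶠ t in 𝓝 (0 : ℂ), t • R (γ t) = 0 := by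
    have hm : γ ⁻¹' Metric.ball p ε ∈ 𝓝 (0 : ℂ) :=
      (hγa 0).continuousAt.preimage_mem_nhds (by rw [hγ0]; exact Metric.ball_mem_nhds p hε)
    refine eventually_eq_zero_of_linear_ode
      (B := fun t => (q - p).1 • P (γ t) + (q - p).2 • Q (γ t)) (hDa 0 (mem_of_mem_nhds hm)) ?_
      (by simp) ?_
    · have h1 : AnalyticAt ℂ (fun t => P (γ t)) 0 :=
        AnalyticAt.comp (by rwa [hγ0]) (hγa 0)
      have h2 : AnalyticAt ℂ (fun t => Q (γ t)) 0 :=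
        AnalyticAt.comp (by rwa [hγ0]) (hγa 0)
      exact (AnalyticAt.fun_smul analyticAt_const h1).fun_add
        (AnalyticAt.fun_smul analyticAt_const h2)
    · filter_upwards [hm] with t ht
      obtain ⟨h1, h2⟩ := hball _ ht
      have h3 : HasDerivAt (fun t => R (γ t)) (fderiv ℂ R (γ t) (q - p)) t :=
        h2.differentiableAt.hasFDerivAt.comp_hasDerivAt t (hd t)
      have h4 : HasDerivAt (fun t => t • R (γ t))
          (t • fderiv ℂ R (γ t) (q - p) + (1 : ℂ) • R (γ t)) t :=
        (hasDerivAt_id t).smul h3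
      rw [h4.deriv]
      have h5 : γ t - p = t • (q - p) := by simp [hγ]
      rw [h5, map_smul] at h1
      rw [h1]
      simp [smul_add, mul_smul]
  have h1 := hDa.eqOn_zero_of_preconnected_of_eventuallyEq_zero hconv.isPreconnected
    (show (0 : ℂ) ∈ γ ⁻¹' Metric.ball p ε by simpa [hγ0] using hε) h0
    (show (1 : ℂ) ∈ γ ⁻¹' Metric.ball p ε by simpa only [Set.mem_preimage, hγ1] using hq)
  simpa [hγ1] using h1

open unitInterval BoundedContinuousFunction

/-- The restriction of an analytic function to the segment `[0, z]`, parametrized by `[0, 1]`,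
depends analytically on `z` as an element of the Banach space of bounded continuous functions: each
homogeneous term `pₙ` of the power series contributes `sⁿ pₙ(z, …, z)`. -/
theorem exists_analyticAt_radial_restriction {G V : Type*} [NormedAddCommGroup G] [NormedSpace ℂ G]
    [CompleteSpace G] [NormedAddCommGroup V] [NormedSpace ℂ V] {f : V → G}
    (hf : AnalyticAt ℂ f 0) :
    ∃ a : V → (I →ᵇ G), AnalyticAt ℂ a 0 ∧
      ∀ᶠ z in 𝓝 (0 : V), ∀ s : I, a z s = f (((s : ℝ) : ℂ) • z) := by
  obtain ⟨ps, r, hps⟩ := hf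
  let L (n : ℕ) : G →L[ℂ] (I →ᵇ G) := LinearMap.mkContinuous
    { toFun := fun g => mkOfCompact ⟨fun s => (((s : ℝ) : ℂ) ^ n) • g, by fun_prop⟩
      map_add' := fun g h => by ext s; simp
      map_smul' := fun c g => by ext s; exact smul_comm _ _ _ } 1 (fun g => by
        rw [BoundedContinuousFunction.norm_le (by positivity)]
        intro s
        simp only [LinearMap.coe_mk, AddHom.coe_mk, mkOfCompact_apply, ContinuousMap.coe_mk,
          norm_smul, norm_pow,         Complex.norm_real, Real.norm_eq_abs, abs_of_nonneg s.2.1]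
        exact mul_le_mul_of_nonneg_right (pow_le_one₀ s.2.1 s.2.2) (norm_nonneg _))
  have hL (n : ℕ) : ‖L n‖ ≤ 1 := LinearMap.mkContinuous_norm_le _ zero_le_one _
  let qs : FormalMultilinearSeries ℂ V (I →ᵇ G) :=
    fun n => (L n).compContinuousMultilinearMap (ps n)
  have hrad : r ≤ qs.radius := hps.r_le.trans <|
    FormalMultilinearSeries.radius_le_of_le fun n =>
      ((L n).norm_compContinuousMultilinearMap_le (ps n)).trans
        (mul_le_of_le_one_left (norm_nonneg _) (hL n))
  have hpos : 0 < qs.radius := hps.r_pos.trans_le hrad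
  have hq := qs.hasFPowerSeriesOnBall hpos
  refine ⟨qs.sum, hq.analyticAt, ?_⟩
  filter_upwards [Metric.eball_mem_nhds (0 : V) hps.r_pos] with z hz s
  have h1 := (evalCLM ℂ s).hasSum (hq.hasSum (Metric.eball_subset_eball hrad hz))
  have hsz : ((s : ℝ) : ℂ) • z ∈ Metric.eball (0 : V) r := by
    rw [Metric.mem_eball, edist_zero_right] at hz ⊢
    refine lt_of_le_of_lt ?_ hz
    rw [enorm_le_iff_norm_le, norm_smul, Complex.norm_real, Real.norm_eq_abs, abs_of_nonneg s.2.1]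
    exact mul_le_of_le_one_left (norm_nonneg _) s.2.2
  have h2 := hps.hasSum hsz
  simp only [zero_add] at h1 h2
  refine h1.unique ?_
  convert h2 using 2 with n
  have h3 := (ps n).map_smul_univ (fun _ => ((s : ℝ) : ℂ)) (fun _ => z)
  rw [Finset.prod_const, Finset.card_univ, Fintype.card_fin] at h3
  exact h3.symm

theorem continuous_coefficient_apply (a : (I →ᵇ E →L[ℂ] E)) (G : (I →ᵇ E)) :
    Continuous fun s : ℝ =>
      a (Set.projIcc 0 1 zero_le_one s) (G (Set.projIcc 0 1 zero_le_one s)) := by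
  fun_prop

/-- The primitive `t ↦ ∫₀ᵗ a(s) G(s) ds` on `[0, 1]`; the integrand is extended to all of `ℝ` by
its values at the end points. -/
noncomputable def volterraFun (a : (I →ᵇ E →L[ℂ] E)) (G : (I →ᵇ E)) : (I →ᵇ E) :=
  mkOfCompact ⟨fun t => ∫ s in (0 : ℝ)..t,
    a (Set.projIcc 0 1 zero_le_one s) (G (Set.projIcc 0 1 zero_le_one s)),
  (intervalIntegral.continuous_primitive (fun _ _ =>
    (continuous_coefficient_apply a G).intervalIntegrable _ _) 0).comp continuous_subtype_val⟩

/-- `volterraFun` as a continuous bilinear map in the coefficient `a` and the function `G`. -/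
noncomputable def volterra : (I →ᵇ E →L[ℂ] E) →L[ℂ] (I →ᵇ E) →L[ℂ] (I →ᵇ E) :=
  have hi (a : (I →ᵇ E →L[ℂ] E)) (G : (I →ᵇ E)) (t : ℝ) :=
    (continuous_coefficient_apply a G).intervalIntegrable (μ := MeasureTheory.volume) 0 t
  LinearMap.mkContinuous₂ (LinearMap.mk₂ ℂ (volterraFun (E := E))
    (fun a b G => by
      ext t; simp [volterraFun, intervalIntegral.integral_add (hi a G t) (hi b G t)])
    (fun c a G => by ext t; simp [volterraFun])
    (fun a G H => by
      ext t; simp [volterraFun, intervalIntegral.integral_add (hi a G t) (hi a H t)])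
    (fun c a G => by ext t; simp [volterraFun])) 1 (fun a G => by
      rw [LinearMap.mk₂_apply, BoundedContinuousFunction.norm_le (by positivity)]
      intro t
      refine (intervalIntegral.norm_integral_le_of_norm_le_const (C := ‖a‖ * ‖G‖)
        fun s _ => ?_).trans ?_
      · exact (ContinuousLinearMap.le_opNorm _ _).trans
          (mul_le_mul (a.norm_coe_le_norm _) (G.norm_coe_le_norm _) (norm_nonneg _)
            (norm_nonneg a))
      · rw [sub_zero, abs_of_nonneg t.2.1, one_mul]
        exact mul_le_of_le_one_right (by positivity) t.2.2)

theorem volterra_apply (a : (I →ᵇ E →L[ℂ] E)) (G : (I →ᵇ E)) (t : I) :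
    volterra a G t = ∫ s in (0 : ℝ)..t,
      a (Set.projIcc 0 1 zero_le_one s) (G (Set.projIcc 0 1 zero_le_one s)) := by
  simp [volterra, volterraFun]

/-- The part of the system `F_x = P F`, `F_y = Q F` along the rays from the origin is solvable. On
the ray through `z` it is the integral equation `(1 - T z) G = c` with `T z` a Volterra operator;
as `T` is analytic and `T 0 = 0`, the solution is analytic in `z`, and its value at time `1` is
`F z`. -/
theorem exists_radial_solution_zero [CompleteSpace E] {P Q : C2 → E →L[ℂ] E}
    (hP : AnalyticAt ℂ P 0) (hQ : AnalyticAt ℂ Q 0) (c : E) :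
    ∃ F : C2 → E, AnalyticAt ℂ F 0 ∧ F 0 = c ∧
      ∀ᶠ z in 𝓝 (0 : C2), fderiv ℂ F z z = (z.1 • P z + z.2 • Q z) (F z) := by
  obtain ⟨aP, haP, hPs⟩ := exists_analyticAt_radial_restriction hP
  obtain ⟨aQ, haQ, hQs⟩ := exists_analyticAt_radial_restriction hQ
  set a : C2 → (I →ᵇ E →L[ℂ] E) := fun z => z.1 • aP z + z.2 • aQ z with ha
  have haa : AnalyticAt ℂ a 0 :=
    (analyticAt_fst.fun_smul haP).fun_add (analyticAt_snd.fun_smul haQ)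
  set T : C2 → (I →ᵇ E) →L[ℂ] (I →ᵇ E) := fun z => volterra (a z) with hT
  have hTa : AnalyticAt ℂ T 0 := by
    have hv : AnalyticAt ℂ (fun b : I →ᵇ E →L[ℂ] E => volterra b) (a 0) :=
      ContinuousLinearMap.analyticAt _ _
    exact hv.comp haa
  have hT0 : T 0 = 0 := by simp [hT, ha]
  set S : C2 → (I →ᵇ E) →L[ℂ] (I →ᵇ E) := fun z => Ring.inverse (1 - T z) with hS
  have hSa : AnalyticAt ℂ S 0 := by
    have h1 : AnalyticAt ℂ (fun z => 1 - T z) 0 := analyticAt_const.fun_sub hTa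
    have h2 : AnalyticAt ℂ (Ring.inverse : ((I →ᵇ E) →L[ℂ] (I →ᵇ E)) → _) (1 - T 0) := by
      rw [hT0, sub_zero]
      exact analyticAt_inverse 1
    exact AnalyticAt.comp (f := fun z => 1 - T z) h2 h1
  set k : (I →ᵇ E) := BoundedContinuousFunction.const I c with hk
  set F : C2 → E := fun z => S z k 1 with hF
  have hFa : AnalyticAt ℂ F 0 :=
    AnalyticAt.comp (f := fun z => S z k) ((evalCLM ℂ (β := E) (1 : I)).analyticAt _)
      (analyticAt_clm_apply hSa analyticAt_const)
  have hunit : ∀ᶠ z in 𝓝 (0 : C2), IsUnit (1 - T z) := by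
    have h1 : ContinuousAt (fun z => 1 - T z) 0 := continuousAt_const.sub hTa.continuousAt
    refine h1.eventually_mem (Units.isOpen.mem_nhds ?_)
    simp [hT0]
  refine ⟨F, hFa, by simp [hF, hS, hT0, hk], ?_⟩
  obtain ⟨ε, hε, hball⟩ := Metric.eventually_nhds_iff_ball.1
    (hunit.and (hPs.and (hQs.and hFa.eventually_analyticAt)))
  refine Metric.eventually_nhds_iff_ball.2 ⟨ε, hε, fun z hz => ?_⟩
  obtain ⟨hu, hp, hq, hFz⟩ := hball z hz
  set G := S z k with hG
  set f : ℝ → E := fun s =>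
    a z (Set.projIcc 0 1 zero_le_one s) (G (Set.projIcc 0 1 zero_le_one s)) with hf
  have hfc : Continuous f := continuous_coefficient_apply _ _
  -- the integral equation
  have hint (t : I) : G t = c + ∫ s in (0 : ℝ)..t, f s := by
    have h1 : (1 - T z) G = k := by
      have := congrArg (fun A : (I →ᵇ E) →L[ℂ] (I →ᵇ E) => A k) (Ring.mul_inverse_cancel _ hu)
      exact this
    have h2 : G t - volterra (a z) G t = c := congrArg (fun g : (I →ᵇ E) => g t) h1
    rw [volterra_apply] at h2
    rw [← h2, sub_add_cancel]
  have hscale (τ : I) : F (((τ : ℝ) : ℂ) • z) = G τ := by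
    have hτz : ((τ : ℝ) : ℂ) • z ∈ Metric.ball (0 : C2) ε := by
      rw [mem_ball_zero_iff] at hz ⊢
      refine lt_of_le_of_lt ?_ hz
      rw [norm_smul, Complex.norm_real, Real.norm_eq_abs, abs_of_nonneg τ.2.1]
      exact mul_le_of_le_one_left (norm_nonneg _) τ.2.2
    obtain ⟨hu', hp', hq', -⟩ := hball _ hτz
    set H : (I →ᵇ E) := mkOfCompact ⟨fun s => G (τ * s), by fun_prop⟩ with hH
    have h1 : (1 - T (((τ : ℝ) : ℂ) • z)) H = k := by
      ext t
      change G (τ * t) - volterra (a (((τ : ℝ) : ℂ) • z)) H t = c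
      rw [volterra_apply, hint, sub_eq_iff_eq_add, add_right_inj]
      have h2 := intervalIntegral.smul_integral_comp_mul_left (a := 0) (b := (t : ℝ)) f (τ : ℝ)
      rw [mul_zero] at h2
      rw [show ((τ * t : I) : ℝ) = (τ : ℝ) * (t : ℝ) from rfl, ← h2,
        ← intervalIntegral.integral_smul]
      refine intervalIntegral.integral_congr fun s hs => ?_
      rw [Set.uIcc_of_le t.2.1] at hs
      have hs1 : s ∈ Set.Icc (0 : ℝ) 1 := ⟨hs.1, hs.2.trans t.2.2⟩
      have e1 : Set.projIcc 0 1 zero_le_one s = (⟨s, hs1⟩ : I) := Set.projIcc_of_mem _ hs1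
      have hs2 : (τ : ℝ) * s ∈ Set.Icc (0 : ℝ) 1 := (τ * ⟨s, hs1⟩ : I).2
      have e2 : Set.projIcc 0 1 zero_le_one ((τ : ℝ) * s) = (τ * ⟨s, hs1⟩ : I) :=
        Set.projIcc_of_mem _ hs2
      simp only [hf, e1, e2, ha, coe_add, coe_smul, Pi.add_apply, hp', hq', hp, hq,
        hH, mkOfCompact_apply, ContinuousMap.coe_mk]
      simp only [smul_smul, Set.Icc.coe_mul, Complex.ofReal_mul, Prod.smul_fst, Prod.smul_snd,
        smul_eq_mul, _root_.add_apply, _root_.smul_apply, smul_add,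
        ← Complex.coe_smul, mul_comm]
    have h3 : S (((τ : ℝ) : ℂ) • z) k = H := by
      rw [← h1]
      exact congrArg (fun A : (I →ᵇ E) →L[ℂ] (I →ᵇ E) => A H) (Ring.inverse_mul_cancel _ hu')
    simp only [hF, h3, hH, mkOfCompact_apply, ContinuousMap.coe_mk, mul_one]
  have hd1 : HasDerivWithinAt (fun τ : ℝ => F ((τ : ℂ) • z)) (f 1) (Set.Icc 0 1) 1 := by
    have h1 : HasDerivAt (fun τ : ℝ => c + ∫ s in (0 : ℝ)..τ, f s) (f 1) 1 :=
      (intervalIntegral.integral_hasDerivAt_right (hfc.intervalIntegrable _ _)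
        (hfc.stronglyMeasurableAtFilter _ _) hfc.continuousAt).const_add c
    refine h1.hasDerivWithinAt.congr_of_mem (fun τ hτ => ?_) (by simp)
    exact (hscale ⟨τ, hτ⟩).trans (hint ⟨τ, hτ⟩)
  have hd2 : HasDerivAt (fun τ : ℝ => F ((τ : ℂ) • z)) (fderiv ℂ F z z) 1 := by
    have h1 : HasDerivAt (fun τ : ℂ => τ • z) z ((1 : ℝ) : ℂ) := by
      simpa using (hasDerivAt_id ((1 : ℝ) : ℂ)).smul_const z
    have h2 : HasFDerivAt F (fderiv ℂ F z) (((1 : ℝ) : ℂ) • z) := by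
      simpa using hFz.differentiableAt.hasFDerivAt
    have h3 : HasDerivAt (fun τ : ℂ => F (τ • z)) (fderiv ℂ F z z) ((1 : ℝ) : ℂ) :=
      HasFDerivAt.comp_hasDerivAt (f := fun τ : ℂ => τ • z) _ h2 h1
    simpa [Function.comp_def] using HasDerivAt.scomp (1 : ℝ) h3 Complex.ofRealCLM.hasDerivAt
  have h3 := (uniqueDiffOn_Icc_zero_one 1 (by simp)).eq_deriv _ hd2.hasDerivWithinAt hd1
  have hz1 : F z = G 1 := rfl
  rw [h3, hz1]
  have e1 : Set.projIcc 0 1 zero_le_one (1 : ℝ) = (1 : I) := Set.projIcc_of_mem _ (by simp)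
  simp only [hf, e1, ha, coe_add, coe_smul, Pi.add_apply, hp, hq, Set.Icc.coe_one,
    Complex.ofReal_one, one_smul]

theorem exists_radial_solution [CompleteSpace E] {P Q : C2 → E →L[ℂ] E} {p : C2}
    (hP : AnalyticAt ℂ P p) (hQ : AnalyticAt ℂ Q p) (c : E) :
    ∃ F : C2 → E, AnalyticAt ℂ F p ∧ F p = c ∧
      ∀ᶠ q in 𝓝 p, fderiv ℂ F q (q - p) = ((q - p).1 • P q + (q - p).2 • Q q) (F q) := by
  have hadd : AnalyticAt ℂ (fun z : C2 => z + p) 0 := by fun_prop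
  have hsub : AnalyticAt ℂ (fun z : C2 => z - p) p := by fun_prop
  obtain ⟨F, hF, hF0, h⟩ := exists_radial_solution_zero
    (P := fun z => P (z + p)) (Q := fun z => Q (z + p))
    (AnalyticAt.comp (by rwa [zero_add]) hadd) (AnalyticAt.comp (by rwa [zero_add]) hadd) c
  refine ⟨fun q => F (q - p), AnalyticAt.comp (by rwa [sub_self]) hsub, by simp [hF0], ?_⟩
  have ht : Filter.Tendsto (fun z : C2 => z - p) (𝓝 p) (𝓝 0) := by
    simpa using hsub.continuousAt.tendsto
  filter_upwards [ht.eventually h] with q hq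
  rw [fderiv_comp_sub]
  simpa using hq

/-- Solvability of `F_x = P F`, `F_y = Q F` under the integrability condition
`P_y + P Q = Q_x + Q P`. The defect `R dx + S dy` of a solution of the radial part has no radial
component and is closed for the connection; hence `R` and `S` solve the homogeneous radial equation
of `eventually_eq_zero_of_radial`. -/
theorem exists_flat_section [CompleteSpace E] {P Q : C2 → E →L[ℂ] E} {p : C2}
    (hP : AnalyticAt ℂ P p) (hQ : AnalyticAt ℂ Q p)
    (hflat : ∀ᶠ q in 𝓝 p, ∀ e : E, fderiv ℂ P q (0, 1) e + P q (Q q e)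
      = fderiv ℂ Q q (1, 0) e + Q q (P q e)) (c : E) :
    ∃ F : C2 → E, AnalyticAt ℂ F p ∧ F p = c ∧
      ∀ᶠ q in 𝓝 p, fderiv ℂ F q (1, 0) = P q (F q) ∧ fderiv ℂ F q (0, 1) = Q q (F q) := by
  obtain ⟨F, hF, hFp, hrad⟩ := exists_radial_solution hP hQ c
  have dir {G : C2 → E} (q v : C2) :
      fderiv ℂ G q v = v.1 • fderiv ℂ G q (1, 0) + v.2 • fderiv ℂ G q (0, 1) := by
    rw [← map_smul, ← map_smul, ← map_add]
    congr 1
    ext <;> simp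
  have hFe (v : C2) : AnalyticAt ℂ (fun q => fderiv ℂ F q v) p :=
    ((ContinuousLinearMap.apply ℂ E v).analyticAt _).comp hF.fderiv
  set R : C2 → E := fun q => fderiv ℂ F q (1, 0) - P q (F q) with hR
  set S : C2 → E := fun q => fderiv ℂ F q (0, 1) - Q q (F q) with hS
  have hRa : AnalyticAt ℂ R p := (hFe _).fun_sub (analyticAt_clm_apply hP hF)
  have hSa : AnalyticAt ℂ S p := (hFe _).fun_sub (analyticAt_clm_apply hQ hF)
  -- the radial component of the defect `R dx + S dy` vanishes
  have hRS : ∀ᶠ q in 𝓝 p, (q - p).1 • R q + (q - p).2 • S q = 0 := by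
    filter_upwards [hrad] with q hq
    rw [dir q (q - p)] at hq
    simp only [hR, hS, smul_sub]
    rw [sub_add_sub_comm, hq]
    simp
  -- the structure equation of the defect
  have hstr : ∀ᶠ q in 𝓝 p, fderiv ℂ R q (0, 1) + P q (S q)
      = fderiv ℂ S q (1, 0) + Q q (R q) := by
    filter_upwards [hflat, hF.eventually_analyticAt, hP.eventually_analyticAt,
      hQ.eventually_analyticAt] with q h1 h2 h3 h4
    have hd : DifferentiableAt ℂ (fderiv ℂ F) q := h2.fderiv.differentiableAt
    have hsymm : fderiv ℂ (fderiv ℂ F) q (0, 1) (1, 0) = fderiv ℂ (fderiv ℂ F) q (1, 0) (0, 1) :=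
      (h2.contDiffAt (n := ⊤)).isSymmSndFDerivAt_of_omega _ _
    have eR : fderiv ℂ R q (0, 1) = fderiv ℂ (fderiv ℂ F) q (0, 1) (1, 0)
        - (P q (fderiv ℂ F q (0, 1)) + fderiv ℂ P q (0, 1) (F q)) := by
      have := ((hd.hasFDerivAt.clm_apply (hasFDerivAt_const ((1 : ℂ), (0 : ℂ)) q)).fun_sub
        (h3.differentiableAt.hasFDerivAt.clm_apply h2.differentiableAt.hasFDerivAt)).fderiv
      have h5 := congrArg (fun A : C2 →L[ℂ] E => A (0, 1)) this
      simpa using h5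
    have eS : fderiv ℂ S q (1, 0) = fderiv ℂ (fderiv ℂ F) q (1, 0) (0, 1)
        - (Q q (fderiv ℂ F q (1, 0)) + fderiv ℂ Q q (1, 0) (F q)) := by
      have := ((hd.hasFDerivAt.clm_apply (hasFDerivAt_const ((0 : ℂ), (1 : ℂ)) q)).fun_sub
        (h4.differentiableAt.hasFDerivAt.clm_apply h2.differentiableAt.hasFDerivAt)).fderiv
      have h5 := congrArg (fun A : C2 →L[ℂ] E => A (1, 0)) this
      simpa using h5
    rw [eR, eS, hsymm]
    simp only [hR, hS, map_sub]
    have h6 := h1 (F q)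
    rw [← sub_eq_zero] at h6 ⊢
    rw [← neg_eq_zero, ← h6]
    abel
  -- both partial derivatives of the radial relation
  have hrel : ∀ᶠ q in 𝓝 p, (R q + (q - p).1 • fderiv ℂ R q (1, 0)
      + (q - p).2 • fderiv ℂ S q (1, 0) = 0) ∧ (S q + (q - p).1 • fderiv ℂ R q (0, 1)
      + (q - p).2 • fderiv ℂ S q (0, 1) = 0) := by
    filter_upwards [hRS.eventually_nhds, hRa.eventually_analyticAt, hSa.eventually_analyticAt]
      with q h1 h2 h3
    have h4 : HasFDerivAt (fun q : C2 => (q - p).1 • R q + (q - p).2 • S q) _ q :=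
      (((hasFDerivAt_id q).sub_const p).fst.fun_smul h2.differentiableAt.hasFDerivAt).fun_add
        (((hasFDerivAt_id q).sub_const p).snd.fun_smul h3.differentiableAt.hasFDerivAt)
    have h5 : fderiv ℂ (fun q : C2 => (q - p).1 • R q + (q - p).2 • S q) q = 0 := by
      rw [Filter.EventuallyEq.fderiv_eq (f := fun _ => (0 : E)) h1]
      simp
    have h6 := h4.fderiv.symm.trans h5
    have h7 := congrArg (fun A : C2 →L[ℂ] E => A (1, 0)) h6
    have h8 := congrArg (fun A : C2 →L[ℂ] E => A (0, 1)) h6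
    simp at h7 h8
    constructor
    · rw [← h7]; abel
    · rw [← h8]; abel
  have hR0 : ∀ᶠ q in 𝓝 p, R q = 0 := by
    refine eventually_eq_zero_of_radial hRa hP hQ ?_
    filter_upwards [hRS, hstr, hrel] with q h1 h2 h3
    have h4 : fderiv ℂ S q (1, 0) = fderiv ℂ R q (0, 1) + P q (S q) - Q q (R q) := by
      rw [h2]; abel
    have h5 := h3.1
    rw [h4] at h5
    have h6 : P q ((q - p).1 • R q + (q - p).2 • S q) = 0 := by rw [h1, map_zero]
    rw [map_add, map_smul, map_smul] at h6
    rw [dir q (q - p)]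
    simp only [_root_.add_apply, _root_.smul_apply]
    linear_combination (norm := module) h5 - h6
  have hS0 : ∀ᶠ q in 𝓝 p, S q = 0 := by
    refine eventually_eq_zero_of_radial hSa hP hQ ?_
    filter_upwards [hRS, hstr, hrel] with q h1 h2 h3
    have h4 : fderiv ℂ R q (0, 1) = fderiv ℂ S q (1, 0) + Q q (R q) - P q (S q) := by
      rw [← h2]; abel
    have h5 := h3.2
    rw [h4] at h5
    have h6 : Q q ((q - p).1 • R q + (q - p).2 • S q) = 0 := by rw [h1, map_zero]
    rw [map_add, map_smul, map_smul] at h6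
    rw [dir q (q - p)]
    simp only [_root_.add_apply, _root_.smul_apply]
    linear_combination (norm := module) h5 - h6
  refine ⟨F, hF, hFp, ?_⟩
  filter_upwards [hR0, hS0] with q h1 h2
  exact ⟨sub_eq_zero.1 h1, sub_eq_zero.1 h2⟩

end LinearODE

/-! ### Christoffel symbols of a pulled back flat connection -/

theorem linear_relation_eq_zero {a b c d r s : ℂ} (hJ : a * d - c * b ≠ 0)
    (h1 : r * a + s * b = 0) (h2 : r * c + s * d = 0) : r = 0 ∧ s = 0 := by
  constructor
  · apply (mul_eq_zero.1 (?_ : (a * d - c * b) * r = 0)).resolve_left hJ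
    linear_combination d * h1 - b * h2
  · apply (mul_eq_zero.1 (?_ : (a * d - c * b) * s = 0)).resolve_left hJ
    linear_combination a * h2 - c * h1

/-- The Hessian of `s` at `q` is expressed by its gradient with the Christoffel symbols `A, …, F`:
`s` is at `q` an affine function, to second order, for the connection with `Γ¹₁₁ = A`, `Γ²₁₁ = B`,
`Γ¹₁₂ = C`, `Γ²₁₂ = D`, `Γ¹₂₂ = E`, `Γ²₂₂ = F`. -/
def HasChristoffelAt (A B C D E F s : C2 → ℂ) (q : C2) : Prop :=
  pdx (pdx s) q = A q * pdx s q + B q * pdy s q ∧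
  pdy (pdx s) q = C q * pdx s q + D q * pdy s q ∧
  pdy (pdy s) q = E q * pdx s q + F q * pdy s q

/-- The Jacobian determinant of `(u, v)`. -/
noncomputable def jac (u v : C2 → ℂ) (q : C2) : ℂ := pdx u q * pdy v q - pdx v q * pdy u q

/-- The curvature of the torsion-free connection with Christoffel symbols `A, …, F` vanishes at
`p`. -/
def FlatTorsionFreeAt (A B C D E F : C2 → ℂ) (p : C2) : Prop :=
    (pdy A p - pdx C p + B p * E p - D p * C p = 0) ∧
    (pdy B p - pdx D p + A p * D p + B p * F p - C p * B p - D p * D p = 0) ∧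
    (pdy C p - pdx E p + C p * C p + D p * E p - E p * A p - F p * C p = 0) ∧
    (pdy D p - pdx F p + C p * D p - E p * B p = 0)

/-- Equality of the mixed third derivatives of `s`. -/
theorem HasChristoffelAt.integrability {A B C D E F s : C2 → ℂ} {p : C2}
    (hA : AnalyticAt ℂ A p) (hB : AnalyticAt ℂ B p) (hC : AnalyticAt ℂ C p)
    (hD : AnalyticAt ℂ D p) (hE : AnalyticAt ℂ E p) (hF : AnalyticAt ℂ F p)
    (hs : AnalyticAt ℂ s p)
    (h : ∀ᶠ q in 𝓝 p, HasChristoffelAt A B C D E F s q) :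
    (pdy A p - pdx C p + B p * E p - D p * C p) * pdx s p
      + (pdy B p - pdx D p + A p * D p + B p * F p - C p * B p - D p * D p) * pdy s p = 0 ∧
    (pdy C p - pdx E p + C p * C p + D p * E p - E p * A p - F p * C p) * pdx s p
      + (pdy D p - pdx F p + C p * D p - E p * B p) * pdy s p = 0 := by
  obtain ⟨e1, e2, e3⟩ := h.self_of_nhds
  have h1 : pdx (pdx s) =ᶠ[𝓝 p] fun q => A q * pdx s q + B q * pdy s q :=
    h.mono fun q hq => hq.1
  have h2 : pdy (pdx s) =ᶠ[𝓝 p] fun q => C q * pdx s q + D q * pdy s q :=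
    h.mono fun q hq => hq.2.1
  have h3 : pdy (pdy s) =ᶠ[𝓝 p] fun q => E q * pdx s q + F q * pdy s q :=
    h.mono fun q hq => hq.2.2
  have k1 := h1.pdy.self_of_nhds
  have k2 := h2.pdx.self_of_nhds
  have k2' := h2.pdy.self_of_nhds
  have k3 := h3.pdx.self_of_nhds
  have c1 := pdx_pdy_comm hs.pdx
  have c2 := pdx_pdy_comm hs.pdy
  have c0 := pdx_pdy_comm hs
  have c3 : pdy (pdx (pdy s)) p = pdy (pdy (pdx s)) p :=
    (Filter.EventuallyEq.pdy
      (hs.eventually_analyticAt.mono fun q hq => pdx_pdy_comm hq)).self_of_nhds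
  simp (disch := fun_prop) only [pdx_add, pdy_add, pdx_mul, pdy_mul] at k1 k2 k2' k3
  rw [c0] at *
  rw [e1, e2, e3] at *
  constructor
  · linear_combination k2 - k1 - c1
  · linear_combination k3 - k2' - c2 - c3

theorem flatTorsionFreeAt_of_christoffel {A B C D E F u v : C2 → ℂ} {p : C2}
    (hA : AnalyticAt ℂ A p) (hB : AnalyticAt ℂ B p) (hC : AnalyticAt ℂ C p)
    (hD : AnalyticAt ℂ D p) (hE : AnalyticAt ℂ E p) (hF : AnalyticAt ℂ F p)
    (hu : AnalyticAt ℂ u p) (hv : AnalyticAt ℂ v p) (hJ : jac u v p ≠ 0)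
    (hcu : ∀ᶠ q in 𝓝 p, HasChristoffelAt A B C D E F u q)
    (hcv : ∀ᶠ q in 𝓝 p, HasChristoffelAt A B C D E F v q) :
    FlatTorsionFreeAt A B C D E F p := by
  obtain ⟨u1, u2⟩ := HasChristoffelAt.integrability hA hB hC hD hE hF hu hcu
  obtain ⟨v1, v2⟩ := HasChristoffelAt.integrability hA hB hC hD hE hF hv hcv
  obtain ⟨r1, r2⟩ := linear_relation_eq_zero hJ u1 v1
  obtain ⟨r3, r4⟩ := linear_relation_eq_zero hJ u2 v2
  exact ⟨r1, r2, r3, r4⟩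

/-- The Tresse system for the projectively invariant part `K = (A - 2 D) / 3`, `L = E`, `M = B`,
`N = (F - 2 C) / 3` of a flat torsion-free connection. -/
theorem tresse_of_flat {A B C D E F : C2 → ℂ} {p : C2}
    (hA : AnalyticAt ℂ A p) (hB : AnalyticAt ℂ B p) (hC : AnalyticAt ℂ C p)
    (hD : AnalyticAt ℂ D p) (hE : AnalyticAt ℂ E p) (hF : AnalyticAt ℂ F p)
    (h : ∀ᶠ q in 𝓝 p, FlatTorsionFreeAt A B C D E F q) :
    TresseSystem (fun q => 3⁻¹ * (A q - 2 * D q)) E B (fun q => 3⁻¹ * (F q - 2 * C q)) {p} := by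
  intro p' hp'
  rw [Set.mem_singleton_iff.1 hp']
  obtain ⟨r1, r2, r3, r4⟩ := h.self_of_nhds
  have hxK : pdx (fun q => 3⁻¹ * (A q - 2 * D q)) =ᶠ[𝓝 p]
      fun q => 3⁻¹ * (pdx A q - 2 * pdx D q) := by
    filter_upwards [hA.eventually_analyticAt, hD.eventually_analyticAt] with q a b
    simp (disch := fun_prop) [pdx_sub, pdx_mul]
  have hyK : pdy (fun q => 3⁻¹ * (A q - 2 * D q)) =ᶠ[𝓝 p]
      fun q => 3⁻¹ * (pdy A q - 2 * pdy D q) := by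
    filter_upwards [hA.eventually_analyticAt, hD.eventually_analyticAt] with q a b
    simp (disch := fun_prop) [pdy_sub, pdy_mul]
  have hxN : pdx (fun q => 3⁻¹ * (F q - 2 * C q)) =ᶠ[𝓝 p]
      fun q => 3⁻¹ * (pdx F q - 2 * pdx C q) := by
    filter_upwards [hF.eventually_analyticAt, hC.eventually_analyticAt] with q a b
    simp (disch := fun_prop) [pdx_sub, pdx_mul]
  have hyN : pdy (fun q => 3⁻¹ * (F q - 2 * C q)) p = 3⁻¹ * (pdy F p - 2 * pdy C p) := by
    simp (disch := fun_prop) [pdy_sub, pdy_mul]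
  have R1 := Filter.EventuallyEq.pdx (p := p) (g := fun _ => 0) (h.mono fun q hq => hq.1)
  have R1' := Filter.EventuallyEq.pdy (p := p) (g := fun _ => 0) (h.mono fun q hq => hq.1)
  have R2 := Filter.EventuallyEq.pdy (p := p) (g := fun _ => 0) (h.mono fun q hq => hq.2.1)
  have R3 := Filter.EventuallyEq.pdx (p := p) (g := fun _ => 0) (h.mono fun q hq => hq.2.2.1)
  have R4 := Filter.EventuallyEq.pdx (p := p) (g := fun _ => 0) (h.mono fun q hq => hq.2.2.2)
  have R4' := Filter.EventuallyEq.pdy (p := p) (g := fun _ => 0) (h.mono fun q hq => hq.2.2.2)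
  replace R1 := R1.self_of_nhds
  replace R1' := R1'.self_of_nhds
  replace R2 := R2.self_of_nhds
  replace R3 := R3.self_of_nhds
  replace R4 := R4.self_of_nhds
  replace R4' := R4'.self_of_nhds
  simp (disch := fun_prop) only [pdx_add, pdx_sub, pdy_add, pdy_sub, pdx_mul, pdy_mul,
    pdx_const, pdy_const] at R1 R1' R2 R3 R4 R4'
  rw [hxK.pdy.self_of_nhds, hyK.pdy.self_of_nhds, hxN.pdx.self_of_nhds, hxN.pdy.self_of_nhds,
    hxK.self_of_nhds, hyK.self_of_nhds, hxN.self_of_nhds, hyN]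
  simp (disch := fun_prop) only [pdx_sub, pdy_sub, pdx_mul, pdy_mul, pdx_const, pdy_const]
  have cA := pdx_pdy_comm hA
  have cC := pdx_pdy_comm hC
  have cD := pdx_pdy_comm hD
  have cF := pdx_pdy_comm hF
  constructor
  · linear_combination (2/3) * R1 + R2 - (1/3) * R4 - (2/3) * cA + (1/3) * cD
      + (-(2/3) * A p + (1/3) * D p) * r1 - C p * r2 - B p * r3
      + ((1/3) * A p - (2/3) * D p) * r4
  · linear_combination (1/3) * R1' - R3 - (2/3) * R4' + cC
      + (-(1/3) * F p + (2/3) * C p) * r1 + E p * r2 + D p * r3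
      + ((2/3) * F p - (1/3) * C p) * r4

/-! ### Projective maps and the vanishing of `K, L, M, N` -/

/-- For a projective map there is an affine function `c` such that `c u` and `c v` are affine too;
their vanishing second derivatives determine the Christoffel symbols. -/
theorem eq_of_isProjectiveOn {A B C D E F u v : C2 → ℂ} {φ : C2 → C2} {U : Set C2}
    (hU : IsOpen U) {q : C2} (hq : q ∈ U) (hφ : ∀ r, φ r = (u r, v r))
    (hu : AnalyticAt ℂ u q) (hv : AnalyticAt ℂ v q) (hJ : jac u v q ≠ 0)
    (hcu : HasChristoffelAt A B C D E F u q) (hcv : HasChristoffelAt A B C D E F v q)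
    (hproj : IsProjectiveOn φ U) : A q = 2 * D q ∧ B q = 0 ∧ E q = 0 ∧ F q = 2 * C q := by
  obtain ⟨g, hg⟩ := hproj
  set l : Fin 3 → C2 → ℂ := fun i r => g.val i 0 * r.1 + g.val i 1 * r.2 + g.val i 2 with hl
  have hla (i : Fin 3) : AnalyticAt ℂ (l i) q := analyticAt_affine _ _ _ q
  have hlx (i : Fin 3) : pdx (l i) = fun _ => g.val i 0 := pdx_affine _ _ _
  have hly (i : Fin 3) : pdy (l i) = fun _ => g.val i 1 := pdy_affine _ _ _
  have key : ∀ r ∈ U, l 2 r ≠ 0 ∧ l 0 r = l 2 r * u r ∧ l 1 r = l 2 r * v r := by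
    intro r hr
    obtain ⟨c, hc, h⟩ := hg r hr
    have h0 := congrFun h 0
    have h1 := congrFun h 1
    have h2 := congrFun h 2
    simp [Matrix.mulVec, dotProduct, Fin.sum_univ_three, hφ] at h0 h1 h2
    have e2 : l 2 r = c := h2
    rw [e2]
    exact ⟨hc, h0, h1⟩
  have e0 : l 0 =ᶠ[𝓝 q] fun r => l 2 r * u r := by
    filter_upwards [hU.mem_nhds hq] with r hr using (key r hr).2.1
  have e1 : l 1 =ᶠ[𝓝 q] fun r => l 2 r * v r := by
    filter_upwards [hU.mem_nhds hq] with r hr using (key r hr).2.2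
  have hc := (key q hq).1
  have a1 := e0.pdx.pdx.self_of_nhds
  have a2 := e0.pdx.pdy.self_of_nhds
  have a3 := e0.pdy.pdy.self_of_nhds
  have b1 := e1.pdx.pdx.self_of_nhds
  have b2 := e1.pdx.pdy.self_of_nhds
  have b3 := e1.pdy.pdy.self_of_nhds
  rw [pdx_pdx_mul (hla 2) hu] at a1
  rw [pdx_pdx_mul (hla 2) hv] at b1
  rw [pdy_pdx_mul (hla 2) hu] at a2
  rw [pdy_pdx_mul (hla 2) hv] at b2
  rw [pdy_pdy_mul (hla 2) hu] at a3
  rw [pdy_pdy_mul (hla 2) hv] at b3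
  simp only [hlx, hly, pdx_const, pdy_const, hcu.1, hcu.2.1, hcu.2.2, hcv.1, hcv.2.1, hcv.2.2]
    at a1 a2 a3 b1 b2 b3
  obtain ⟨r1, r2⟩ := linear_relation_eq_zero (r := l 2 q * A q + 2 * g.val 2 0)
    (s := l 2 q * B q) hJ (by linear_combination -a1) (by linear_combination -b1)
  obtain ⟨r3, r4⟩ := linear_relation_eq_zero (r := l 2 q * C q + g.val 2 1)
    (s := l 2 q * D q + g.val 2 0) hJ (by linear_combination -a2) (by linear_combination -b2)
  obtain ⟨r5, r6⟩ := linear_relation_eq_zero (r := l 2 q * E q)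
    (s := l 2 q * F q + 2 * g.val 2 1) hJ (by linear_combination -a3) (by linear_combination -b3)
  refine ⟨mul_left_cancel₀ hc ?_, (mul_eq_zero.1 r2).resolve_left hc,
    (mul_eq_zero.1 r5).resolve_left hc, mul_left_cancel₀ hc ?_⟩
  · linear_combination r1 - 2 * r4
  · linear_combination r6 - 2 * r3

/-- When `K = L = M = N = 0`, flatness allows to solve `c_x = -D c`, `c_y = -C c`, and then all
second derivatives of `c` vanish. -/
theorem exists_affine_factor {C D : C2 → ℂ} {p : C2}
    (hC : AnalyticAt ℂ C p) (hD : AnalyticAt ℂ D p)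
    (hflat : ∀ᶠ q in 𝓝 p, FlatTorsionFreeAt (fun q => 2 * D q) (fun _ => 0) C D (fun _ => 0)
      (fun q => 2 * C q) q) :
    ∃ c : C2 → ℂ, AnalyticAt ℂ c p ∧ c p = 1 ∧
      ∀ᶠ q in 𝓝 p, pdx c q = -D q * c q ∧ pdy c q = -C q * c q ∧
        pdx (pdx c) q = 0 ∧ pdy (pdx c) q = 0 ∧ pdy (pdy c) q = 0 := by
  have hrel : ∀ᶠ q in 𝓝 p, pdy D q = pdx C q ∧ pdx D q = D q ^ 2 ∧ pdy C q = C q ^ 2 ∧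
      pdy D q = D q * C q := by
    filter_upwards [hflat, hC.eventually_analyticAt, hD.eventually_analyticAt] with q h h1 h2
    obtain ⟨e1, e2, e3, e4⟩ := h
    simp (disch := fun_prop) only [pdx_mul, pdy_mul, pdx_const, pdy_const] at e1 e2 e3 e4
    have e5 : pdy D q = pdx C q := by linear_combination (1 / 3) * e1 + (1 / 3) * e4
    refine ⟨e5, by linear_combination -e2, by linear_combination e3, ?_⟩
    linear_combination e1 - e5
  obtain ⟨c, hc, hcp, h⟩ := exists_flat_section
    (P := fun q => (-D q) • ContinuousLinearMap.id ℂ ℂ)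
    (Q := fun q => (-C q) • ContinuousLinearMap.id ℂ ℂ) (p := p)
    (hD.fun_neg.fun_smul analyticAt_const) (hC.fun_neg.fun_smul analyticAt_const) (by
      filter_upwards [hrel, hC.eventually_analyticAt, hD.eventually_analyticAt] with q h h1 h2 e
      have d1 := h1.differentiableAt.hasFDerivAt.fun_neg.smul_const (ContinuousLinearMap.id ℂ ℂ)
      have d2 := h2.differentiableAt.hasFDerivAt.fun_neg.smul_const (ContinuousLinearMap.id ℂ ℂ)
      rw [d1.fderiv, d2.fderiv]
      have e1 : fderiv ℂ D q (0, 1) = fderiv ℂ C q (1, 0) := h.1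
      simp [e1]
      ring) 1
  have hx : pdx c =ᶠ[𝓝 p] fun q => -D q * c q := h.mono fun q hq => by simpa [pdx] using hq.1
  have hy : pdy c =ᶠ[𝓝 p] fun q => -C q * c q := h.mono fun q hq => by simpa [pdy] using hq.2
  refine ⟨c, hc, hcp, ?_⟩
  filter_upwards [hx.eventually_nhds, hy.eventually_nhds, hrel, hC.eventually_analyticAt,
    hD.eventually_analyticAt, hc.eventually_analyticAt] with q h1 h2 h3 h4 h5 h6
  have k1 := (Filter.EventuallyEq.pdx h1).self_of_nhds
  have k2 := (Filter.EventuallyEq.pdy h1).self_of_nhds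
  have k3 := (Filter.EventuallyEq.pdy h2).self_of_nhds
  obtain ⟨r1, r2, r3, r4⟩ := h3
  simp (disch := fun_prop) only [pdx_mul, pdy_mul, pdx_neg, pdy_neg, h1.self_of_nhds,
    h2.self_of_nhds, r2, r3, r4] at k1 k2 k3
  refine ⟨h1.self_of_nhds, h2.self_of_nhds, ?_, ?_, ?_⟩
  · rw [k1]; ring
  · rw [k2]; ring
  · rw [k3]; ring

/-- The hypotheses are local at `p`, the conclusion holds on all of `U` by the identity theorem. -/
theorem isProjectiveOn_of_christoffel {C D u v : C2 → ℂ} {φ : C2 → C2} {U : Set C2}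
    (hU : IsPreconnected U) (hUo : IsOpen U) {p : C2} (hp : p ∈ U)
    (hφ : ∀ r, φ r = (u r, v r))
    (hu : AnalyticOnNhd ℂ u U) (hv : AnalyticOnNhd ℂ v U) (hJ : jac u v p ≠ 0)
    (hC : AnalyticAt ℂ C p) (hD : AnalyticAt ℂ D p)
    (hflat : ∀ᶠ q in 𝓝 p, FlatTorsionFreeAt (fun q => 2 * D q) (fun _ => 0) C D (fun _ => 0)
      (fun q => 2 * C q) q)
    (hcu : ∀ᶠ q in 𝓝 p, HasChristoffelAt (fun q => 2 * D q) (fun _ => 0) C D (fun _ => 0)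
      (fun q => 2 * C q) u q)
    (hcv : ∀ᶠ q in 𝓝 p, HasChristoffelAt (fun q => 2 * D q) (fun _ => 0) C D (fun _ => 0)
      (fun q => 2 * C q) v q) : IsProjectiveOn φ U := by
  obtain ⟨c, hc, hcp, h⟩ := exists_affine_factor hC hD hflat
  obtain ⟨α₂, β₂, γ₂, h₂⟩ := eventually_affine_of_second_pd_eq_zero hc
    (h.mono fun q hq => hq.2.2.1) (h.mono fun q hq => hq.2.2.2.1) (h.mono fun q hq => hq.2.2.2.2)
  have haff {s : C2 → ℂ} (hs : AnalyticAt ℂ s p)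
      (hcs : ∀ᶠ q in 𝓝 p, HasChristoffelAt (fun q => 2 * D q) (fun _ => 0) C D (fun _ => 0)
        (fun q => 2 * C q) s q) :
      ∃ α β γ : ℂ, ∀ᶠ q in 𝓝 p, c q * s q = α * q.1 + β * q.2 + γ := by
    refine eventually_affine_of_second_pd_eq_zero (hc.fun_mul hs) ?_ ?_ ?_
    all_goals
      filter_upwards [h, hcs, hc.eventually_analyticAt, hs.eventually_analyticAt]
        with q h1 h2 h3 h4
      obtain ⟨e1, e2, e3, e4, e5⟩ := h1
      obtain ⟨f1, f2, f3⟩ := h2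
    · rw [pdx_pdx_mul h3 h4, e3, e1, f1]; ring
    · rw [pdy_pdx_mul h3 h4, e4, e1, e2, f2]; ring
    · rw [pdy_pdy_mul h3 h4, e5, e2, f3]; ring
  obtain ⟨α₀, β₀, γ₀, h₀⟩ := haff (hu p hp) hcu
  obtain ⟨α₁, β₁, γ₁, h₁⟩ := haff (hv p hp) hcv
  set l₂ : C2 → ℂ := fun q => α₂ * q.1 + β₂ * q.2 + γ₂ with hl₂
  have ha₂ (q : C2) : AnalyticAt ℂ l₂ q := analyticAt_affine _ _ _ q
  have hext {s : C2 → ℂ} (hs : AnalyticOnNhd ℂ s U) {α β γ : ℂ}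
      (h3 : ∀ᶠ q in 𝓝 p, c q * s q = α * q.1 + β * q.2 + γ) :
      ∀ q ∈ U, α * q.1 + β * q.2 + γ = l₂ q * s q := by
    have h4 : AnalyticOnNhd ℂ (fun q : C2 => α * q.1 + β * q.2 + γ - l₂ q * s q) U :=
      fun q hq => (analyticAt_affine _ _ _ q).fun_sub ((ha₂ q).fun_mul (hs q hq))
    have h5 := h4.eqOn_zero_of_preconnected_of_eventuallyEq_zero hU hp (by
      filter_upwards [h₂, h3] with q h6 h7
      simp only [hl₂, Pi.zero_apply]
      rw [← h6, ← h7, sub_self])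
    exact fun q hq => sub_eq_zero.1 (h5 hq)
  have k₀ := hext hu h₀
  have k₁ := hext hv h₁
  have hder {s : C2 → ℂ} (hs : AnalyticOnNhd ℂ s U) {α β γ : ℂ}
      (h3 : ∀ q ∈ U, α * q.1 + β * q.2 + γ = l₂ q * s q) :
      α = α₂ * s p + l₂ p * pdx s p ∧ β = β₂ * s p + l₂ p * pdy s p := by
    have h4 : (fun q : C2 => α * q.1 + β * q.2 + γ) =ᶠ[𝓝 p] fun q => l₂ q * s q := by
      filter_upwards [hUo.mem_nhds hp] with q hq using h3 q hq
    have h5 := h4.pdx.self_of_nhds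
    have h6 := h4.pdy.self_of_nhds
    rw [pdx_mul (ha₂ p) (hs p hp)] at h5
    rw [pdy_mul (ha₂ p) (hs p hp)] at h6
    simp only [hl₂, pdx_affine, pdy_affine] at h5 h6
    exact ⟨h5, h6⟩
  have d₀ := hder hu k₀
  have d₁ := hder hv k₁
  have hl₂p : l₂ p = 1 := by rw [← hcp]; exact h₂.self_of_nhds.symm
  set g : Matrix (Fin 3) (Fin 3) ℂ := !![α₀, β₀, γ₀; α₁, β₁, γ₁; α₂, β₂, γ₂] with hg
  have hdet : g.det ≠ 0 := by
    have hdet' : g.det = jac u v p := by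
      have t₀ := k₀ p hp
      have t₁ := k₁ p hp
      rw [hl₂p] at t₀ t₁ d₀ d₁
      have t₂ : α₂ * p.1 + β₂ * p.2 + γ₂ = 1 := hl₂p
      have g₀ : γ₀ = u p - α₀ * p.1 - β₀ * p.2 := by linear_combination t₀
      have g₁ : γ₁ = v p - α₁ * p.1 - β₁ * p.2 := by linear_combination t₁
      have g₂ : γ₂ = 1 - α₂ * p.1 - β₂ * p.2 := by linear_combination t₂
      simp only [hg, Matrix.det_fin_three, jac]
      simp
      rw [g₀, g₁, g₂, d₀.1, d₀.2, d₁.1, d₁.2]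
      ring
    rwa [hdet']
  refine ⟨Matrix.GeneralLinearGroup.mkOfDetNeZero g hdet, fun q hq => ⟨l₂ q, ?_, ?_⟩⟩
  · intro h0
    have hz : g.mulVec ![q.1, q.2, 1] = 0 := by
      have t₀ := k₀ q hq
      have t₁ := k₁ q hq
      rw [h0, zero_mul] at t₀ t₁
      ext i
      fin_cases i <;> simp [hg, Matrix.mulVec, dotProduct, Fin.sum_univ_three]
      exacts [t₀, t₁, h0]
    have := Matrix.eq_zero_of_mulVec_eq_zero hdet hz
    simpa using congrFun this 2
  · change g.mulVec ![q.1, q.2, 1] = _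
    ext i
    fin_cases i <;> simp [hg, Matrix.mulVec, dotProduct, Fin.sum_univ_three, hφ]
    exacts [k₀ q hq, k₁ q hq, rfl]

/-! ### The linear system behind the Tresse equations -/

/-- The coefficient of `s` in the equation for `s_xx` of `IsProjectiveDensityAt`; it is forced by
the first order part of the integrability conditions. -/
noncomputable def coeffXX (K M N : C2 → ℂ) (q : C2) : ℂ :=
  2 * K q * K q - 2 * M q * N q - pdy M q - pdx K q

/-- The coefficient of `s` in the equation for `s_xy` of `IsProjectiveDensityAt`. -/
noncomputable def coeffXY (K L M N : C2 → ℂ) (q : C2) : ℂ :=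
  pdy K q + pdx N q + M q * L q - K q * N q

/-- The coefficient of `s` in the equation for `s_yy` of `IsProjectiveDensityAt`. -/
noncomputable def coeffYY (K L N : C2 → ℂ) (q : C2) : ℂ :=
  2 * N q * N q - 2 * L q * K q - pdx L q - pdy N q

/-- The linear system whose solution space is, for `K = L = M = N = 0`, the space of affine
functions. Quotients of solutions straighten the curves `y'' = L m ^ 3 - 3 N m ^ 2 + 3 K m - M`. -/
def IsProjectiveDensityAt (K L M N s : C2 → ℂ) (q : C2) : Prop :=
  pdx (pdx s) q = K q * pdx s q + M q * pdy s q + coeffXX K M N q * s q ∧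
  pdy (pdx s) q = -N q * pdx s q - K q * pdy s q + coeffXY K L M N q * s q ∧
  pdy (pdy s) q = L q * pdx s q + N q * pdy s q + coeffYY K L N q * s q

/-- The Tresse equations are the zeroth order part of the integrability conditions of
`IsProjectiveDensityAt`. -/
theorem coeff_integrability {K L M N : C2 → ℂ} {q : C2}
    (hK : AnalyticAt ℂ K q) (hL : AnalyticAt ℂ L q) (hM : AnalyticAt ℂ M q)
    (hN : AnalyticAt ℂ N q) (hT : TresseSystem K L M N {q}) :
    pdy (coeffXX K M N) q + K q * coeffXY K L M N q + M q * coeffYY K L N q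
      = pdx (coeffXY K L M N) q - N q * coeffXX K M N q - K q * coeffXY K L M N q ∧
    pdx (coeffYY K L N) q + N q * coeffXY K L M N q + L q * coeffXX K M N q
      = pdy (coeffXY K L M N) q - K q * coeffYY K L N q - N q * coeffXY K L M N q := by
  obtain ⟨t1, t2⟩ := hT q rfl
  have cK := pdx_pdy_comm hK
  have cL := pdx_pdy_comm hL
  have cM := pdx_pdy_comm hM
  have cN := pdx_pdy_comm hN
  unfold coeffXX coeffXY coeffYY
  simp (disch := fun_prop) only [pdx_add, pdx_sub, pdx_mul, pdy_add, pdy_sub, pdy_mul, pdx_const,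
    pdy_const]
  constructor
  · linear_combination -t1 - cK
  · linear_combination -t2 - cN

section JetOp

open ContinuousLinearMap

variable (π : ℂ × ℂ × ℂ →L[ℂ] ℂ) (f₀ f₁ f₂ g₀ g₁ g₂ : C2 → ℂ)

/-- The endomorphism of the space of `1`-jets `(s, s_x, s_y)` with first row `π` and with the
second and third rows given by the functions `f₀, f₁, f₂` and `g₀, g₁, g₂`. -/
noncomputable def jetOp (q : C2) : ℂ × ℂ × ℂ →L[ℂ] ℂ × ℂ × ℂ :=
  π.prod 0
    + (f₀ q • (0 : ℂ × ℂ × ℂ →L[ℂ] ℂ).prod ((fst ℂ ℂ (ℂ × ℂ)).prod 0)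
      + f₁ q • (0 : ℂ × ℂ × ℂ →L[ℂ] ℂ).prod ((fst ℂ ℂ ℂ ∘L snd ℂ ℂ (ℂ × ℂ)).prod 0)
      + f₂ q • (0 : ℂ × ℂ × ℂ →L[ℂ] ℂ).prod ((snd ℂ ℂ ℂ ∘L snd ℂ ℂ (ℂ × ℂ)).prod 0))
    + (g₀ q • (0 : ℂ × ℂ × ℂ →L[ℂ] ℂ).prod ((0 : ℂ × ℂ × ℂ →L[ℂ] ℂ).prod (fst ℂ ℂ (ℂ × ℂ)))
      + g₁ q • (0 : ℂ × ℂ × ℂ →L[ℂ] ℂ).prod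
        ((0 : ℂ × ℂ × ℂ →L[ℂ] ℂ).prod (fst ℂ ℂ ℂ ∘L snd ℂ ℂ (ℂ × ℂ)))
      + g₂ q • (0 : ℂ × ℂ × ℂ →L[ℂ] ℂ).prod
        ((0 : ℂ × ℂ × ℂ →L[ℂ] ℂ).prod (snd ℂ ℂ ℂ ∘L snd ℂ ℂ (ℂ × ℂ))))

theorem jetOp_apply (q : C2) (e : ℂ × ℂ × ℂ) :
    jetOp π f₀ f₁ f₂ g₀ g₁ g₂ q e = (π e, f₀ q * e.1 + f₁ q * e.2.1 + f₂ q * e.2.2,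
      g₀ q * e.1 + g₁ q * e.2.1 + g₂ q * e.2.2) := by
  simp [jetOp]

variable {f₀ f₁ f₂ g₀ g₁ g₂} {p : C2}

theorem analyticAt_jetOp (hf₀ : AnalyticAt ℂ f₀ p) (hf₁ : AnalyticAt ℂ f₁ p)
    (hf₂ : AnalyticAt ℂ f₂ p) (hg₀ : AnalyticAt ℂ g₀ p) (hg₁ : AnalyticAt ℂ g₁ p)
    (hg₂ : AnalyticAt ℂ g₂ p) : AnalyticAt ℂ (jetOp π f₀ f₁ f₂ g₀ g₁ g₂) p := by
  unfold jetOp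
  fun_prop

theorem fderiv_jetOp_apply (hf₀ : AnalyticAt ℂ f₀ p) (hf₁ : AnalyticAt ℂ f₁ p)
    (hf₂ : AnalyticAt ℂ f₂ p) (hg₀ : AnalyticAt ℂ g₀ p) (hg₁ : AnalyticAt ℂ g₁ p)
    (hg₂ : AnalyticAt ℂ g₂ p) (v : C2) (e : ℂ × ℂ × ℂ) :
    fderiv ℂ (jetOp π f₀ f₁ f₂ g₀ g₁ g₂) p v e = (0,
      fderiv ℂ f₀ p v * e.1 + fderiv ℂ f₁ p v * e.2.1 + fderiv ℂ f₂ p v * e.2.2,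
      fderiv ℂ g₀ p v * e.1 + fderiv ℂ g₁ p v * e.2.1 + fderiv ℂ g₂ p v * e.2.2) := by
  have k {f : C2 → ℂ} (hf : AnalyticAt ℂ f p) (A : ℂ × ℂ × ℂ →L[ℂ] ℂ × ℂ × ℂ) :
      HasFDerivAt (fun q => f q • A) ((fderiv ℂ f p).smulRight A) p :=
    hf.differentiableAt.hasFDerivAt.smul_const A
  have h : HasFDerivAt (jetOp π f₀ f₁ f₂ g₀ g₁ g₂) _ p :=
    ((((k hf₀ _).fun_add (k hf₁ _)).fun_add (k hf₂ _)).const_add _).fun_add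
      (((k hg₀ _).fun_add (k hg₁ _)).fun_add (k hg₂ _))
  rw [h.fderiv]
  simp

end JetOp

theorem exists_projectiveDensity {K L M N : C2 → ℂ} {p : C2}
    (hK : AnalyticAt ℂ K p) (hL : AnalyticAt ℂ L p) (hM : AnalyticAt ℂ M p)
    (hN : AnalyticAt ℂ N p) (hT : ∀ᶠ q in 𝓝 p, TresseSystem K L M N {q}) (c : ℂ × ℂ × ℂ) :
    ∃ s : C2 → ℂ, AnalyticAt ℂ s p ∧ (s p, pdx s p, pdy s p) = c ∧
      ∀ᶠ q in 𝓝 p, IsProjectiveDensityAt K L M N s q := by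
  have hXX {q : C2} (hK : AnalyticAt ℂ K q) (hM : AnalyticAt ℂ M q) (hN : AnalyticAt ℂ N q) :
      AnalyticAt ℂ (coeffXX K M N) q := by unfold coeffXX; fun_prop
  have hXY {q : C2} (hK : AnalyticAt ℂ K q) (hL : AnalyticAt ℂ L q) (hM : AnalyticAt ℂ M q)
      (hN : AnalyticAt ℂ N q) : AnalyticAt ℂ (coeffXY K L M N) q := by unfold coeffXY; fun_prop
  have hYY {q : C2} (hK : AnalyticAt ℂ K q) (hL : AnalyticAt ℂ L q) (hN : AnalyticAt ℂ N q) :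
      AnalyticAt ℂ (coeffYY K L N) q := by unfold coeffYY; fun_prop
  obtain ⟨F, hF, hFp, h⟩ := exists_flat_section
    (P := jetOp (.fst ℂ ℂ ℂ ∘L .snd ℂ ℂ (ℂ × ℂ)) (coeffXX K M N) K M (coeffXY K L M N)
      (fun q => -N q) (fun q => -K q))
    (Q := jetOp (.snd ℂ ℂ ℂ ∘L .snd ℂ ℂ (ℂ × ℂ)) (coeffXY K L M N) (fun q => -N q)
      (fun q => -K q) (coeffYY K L N) L N) (p := p)
    (analyticAt_jetOp _ (hXX hK hM hN) hK hM (hXY hK hL hM hN) hN.fun_neg hK.fun_neg)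
    (analyticAt_jetOp _ (hXY hK hL hM hN) hN.fun_neg hK.fun_neg (hYY hK hL hN) hL hN) (by
      filter_upwards [hT, hK.eventually_analyticAt, hL.eventually_analyticAt,
        hM.eventually_analyticAt, hN.eventually_analyticAt] with q hTq hK hL hM hN e
      obtain ⟨t1, t2⟩ := coeff_integrability hK hL hM hN hTq
      rw [fderiv_jetOp_apply _ (hXX hK hM hN) hK hM (hXY hK hL hM hN) hN.fun_neg hK.fun_neg,
        fderiv_jetOp_apply _ (hXY hK hL hM hN) hN.fun_neg hK.fun_neg (hYY hK hL hN) hL hN]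
      change (0, pdy (coeffXX K M N) q * e.1 + pdy K q * e.2.1 + pdy M q * e.2.2,
          pdy (coeffXY K L M N) q * e.1 + pdy (fun q => -N q) q * e.2.1
            + pdy (fun q => -K q) q * e.2.2) + _
        = (0, pdx (coeffXY K L M N) q * e.1 + pdx (fun q => -N q) q * e.2.1
            + pdx (fun q => -K q) q * e.2.2,
          pdx (coeffYY K L N) q * e.1 + pdx L q * e.2.1 + pdx N q * e.2.2) + _
      simp only [jetOp_apply, ContinuousLinearMap.comp_apply, ContinuousLinearMap.coe_fst',
        ContinuousLinearMap.coe_snd', Prod.mk_add_mk, Prod.mk.injEq, pdx_neg, pdy_neg]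
      refine ⟨trivial, ?_, ?_⟩
      · have k : coeffXY K L M N q = pdy K q + pdx N q + M q * L q - K q * N q := rfl
        have k' : coeffXX K M N q = 2 * K q * K q - 2 * M q * N q - pdy M q - pdx K q := rfl
        linear_combination e.1 * t1 - e.2.1 * k + e.2.2 * k'
      · have k : coeffXY K L M N q = pdy K q + pdx N q + M q * L q - K q * N q := rfl
        have k' : coeffYY K L N q = 2 * N q * N q - 2 * L q * K q - pdx L q - pdy N q := rfl
        linear_combination -e.1 * t2 - e.2.1 * k' + e.2.2 * k) c
  have hF1 : AnalyticAt ℂ (fun q => (F q).1) p := analyticAt_fst.comp hF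
  have hF2 : AnalyticAt ℂ (fun q => (F q).2.1) p :=
    analyticAt_fst.comp (analyticAt_snd.comp hF)
  have hF3 : AnalyticAt ℂ (fun q => (F q).2.2) p :=
    analyticAt_snd.comp (analyticAt_snd.comp hF)
  have hcomp {q v : C2} (hq : AnalyticAt ℂ F q) :
      fderiv ℂ F q v = (fderiv ℂ (fun q => (F q).1) q v, fderiv ℂ (fun q => (F q).2.1) q v,
        fderiv ℂ (fun q => (F q).2.2) q v) := by
    have hd := hq.differentiableAt.hasFDerivAt
    rw [hd.fst.fderiv, hd.snd.fst.fderiv, hd.snd.snd.fderiv]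
    rfl
  set s : C2 → ℂ := fun q => (F q).1 with hs
  have hall : ∀ᶠ q in 𝓝 p, (pdx s q = (F q).2.1 ∧ pdx (fun q => (F q).2.1) q
        = coeffXX K M N q * (F q).1 + K q * (F q).2.1 + M q * (F q).2.2) ∧
      pdy s q = (F q).2.2 ∧ pdy (fun q => (F q).2.1) q
        = coeffXY K L M N q * (F q).1 + -N q * (F q).2.1 + -K q * (F q).2.2 ∧
      pdy (fun q => (F q).2.2) q
        = coeffYY K L N q * (F q).1 + L q * (F q).2.1 + N q * (F q).2.2 := by
    filter_upwards [h, hF.eventually_analyticAt] with q hq hFq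
    obtain ⟨h1, h2⟩ := hq
    rw [hcomp hFq, jetOp_apply] at h1 h2
    simp only [Prod.mk.injEq] at h1 h2
    exact ⟨⟨h1.1, h1.2.1⟩, h2⟩
  have hx : pdx s =ᶠ[𝓝 p] fun q => (F q).2.1 := hall.mono fun q hq => hq.1.1
  have hy : pdy s =ᶠ[𝓝 p] fun q => (F q).2.2 := hall.mono fun q hq => hq.2.1
  refine ⟨s, hF1, ?_, ?_⟩
  · rw [hx.self_of_nhds, hy.self_of_nhds, ← hFp]
  · filter_upwards [hall, hx.eventually_nhds, hy.eventually_nhds] with q hq h1 h2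
    obtain ⟨⟨e1, e2⟩, e3, e4, e5⟩ := hq
    refine ⟨?_, ?_, ?_⟩
    · rw [(Filter.EventuallyEq.pdx h1).self_of_nhds, e1, e3, e2]; ring
    · rw [(Filter.EventuallyEq.pdy h1).self_of_nhds, e1, e3, e4]; ring
    · rw [(Filter.EventuallyEq.pdy h2).self_of_nhds, e1, e3, e5]; ring

/-- Passing to the quotient of two solutions changes the connection `K, …, N` only within its
projective class, by the logarithmic derivative of the denominator. -/
theorem HasChristoffelAt.of_quotient {K L M N s t : C2 → ℂ} {q : C2}
    (hs : AnalyticAt ℂ s q) (ht : AnalyticAt ℂ t q) (hs0 : s q ≠ 0)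
    (hds : IsProjectiveDensityAt K L M N s q) (hdt : IsProjectiveDensityAt K L M N t q) :
    HasChristoffelAt (fun q => K q - 2 * (pdx s q / s q)) M (fun q => -N q - pdy s q / s q)
      (fun q => -K q - pdx s q / s q) L (fun q => N q - 2 * (pdy s q / s q))
      (fun q => t q / s q) q := by
  set u : C2 → ℂ := fun q => t q / s q with hu
  have hua : AnalyticAt ℂ u q := ht.fun_div hs hs0
  have hts : t =ᶠ[𝓝 q] fun q => u q * s q := by
    filter_upwards [hs.continuousAt.eventually_ne hs0] with r hr
    exact (div_mul_cancel₀ _ hr).symm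
  obtain ⟨e1, e2, e3⟩ := hds
  obtain ⟨f1, f2, f3⟩ := hdt
  rw [hts.pdx.pdx.self_of_nhds, hts.pdx.self_of_nhds, hts.pdy.self_of_nhds, hts.self_of_nhds,
    pdx_pdx_mul hua hs, pdx_mul hua hs, pdy_mul hua hs, e1] at f1
  rw [hts.pdx.pdy.self_of_nhds, hts.pdx.self_of_nhds, hts.pdy.self_of_nhds, hts.self_of_nhds,
    pdy_pdx_mul hua hs, pdx_mul hua hs, pdy_mul hua hs, e2] at f2
  rw [hts.pdy.pdy.self_of_nhds, hts.pdx.self_of_nhds, hts.pdy.self_of_nhds, hts.self_of_nhds,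
    pdy_pdy_mul hua hs, pdx_mul hua hs, pdy_mul hua hs, e3] at f3
  refine ⟨?_, ?_, ?_⟩
  · field_simp
    linear_combination f1
  · field_simp
    linear_combination f2
  · field_simp
    linear_combination f3

/-- A map with given `K, L, M, N`; the functions `a` and `b` fix the connection within its
projective class. -/
theorem exists_flattening {K L M N : C2 → ℂ} {p : C2}
    (hK : AnalyticAt ℂ K p) (hL : AnalyticAt ℂ L p) (hM : AnalyticAt ℂ M p)
    (hN : AnalyticAt ℂ N p) (hT : ∀ᶠ q in 𝓝 p, TresseSystem K L M N {q}) :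
    ∃ u v a b : C2 → ℂ, AnalyticAt ℂ u p ∧ AnalyticAt ℂ v p ∧
      AnalyticAt ℂ a p ∧ AnalyticAt ℂ b p ∧ jac u v p ≠ 0 ∧
      ∀ᶠ q in 𝓝 p, ∀ s ∈ ({u, v} : Set (C2 → ℂ)),
        HasChristoffelAt (fun q => K q - 2 * a q) M (fun q => -N q - b q)
          (fun q => -K q - a q) L (fun q => N q - 2 * b q) s q := by
  obtain ⟨s₀, ha₀, hi₀, h₀⟩ := exists_projectiveDensity hK hL hM hN hT (1, 0, 0)
  obtain ⟨s₁, ha₁, hi₁, h₁⟩ := exists_projectiveDensity hK hL hM hN hT (0, 1, 0)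
  obtain ⟨s₂, ha₂, hi₂, h₂⟩ := exists_projectiveDensity hK hL hM hN hT (0, 0, 1)
  simp only [Prod.mk.injEq] at hi₀ hi₁ hi₂
  have hne : s₀ p ≠ 0 := by rw [hi₀.1]; exact one_ne_zero
  refine ⟨fun q => s₁ q / s₀ q, fun q => s₂ q / s₀ q, fun q => pdx s₀ q / s₀ q,
    fun q => pdy s₀ q / s₀ q, ha₁.fun_div ha₀ hne, ha₂.fun_div ha₀ hne,
    ha₀.pdx.fun_div ha₀ hne, ha₀.pdy.fun_div ha₀ hne, ?_, ?_⟩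
  · have hd {t : C2 → ℂ} (ht : AnalyticAt ℂ t p) (ht0 : t p = 0) :
        pdx (fun q => t q / s₀ q) p = pdx t p ∧ pdy (fun q => t q / s₀ q) p = pdy t p := by
      have hua := ht.fun_div ha₀ hne
      have hts : t =ᶠ[𝓝 p] fun q => (t q / s₀ q) * s₀ q := by
        filter_upwards [ha₀.continuousAt.eventually_ne hne] with r hr
        exact (div_mul_cancel₀ _ hr).symm
      have e1 := hts.pdx.self_of_nhds
      have e2 := hts.pdy.self_of_nhds
      rw [pdx_mul hua ha₀] at e1
      rw [pdy_mul hua ha₀] at e2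
      rw [e1, e2]
      simp [hi₀.1, hi₀.2.1, hi₀.2.2]
    simp [jac, hd ha₁ hi₁.1, hd ha₂ hi₂.1, hi₁, hi₂]
  · filter_upwards [h₀, h₁, h₂, ha₀.eventually_analyticAt, ha₁.eventually_analyticAt,
      ha₂.eventually_analyticAt, ha₀.continuousAt.eventually_ne hne] with q d₀ d₁ d₂ k₀ k₁ k₂ hq
    rintro s (rfl | rfl)
    · exact HasChristoffelAt.of_quotient k₀ k₁ hq d₀ d₁
    · exact HasChristoffelAt.of_quotient k₀ k₂ hq d₀ d₂

/-! ### Slopes of linear webs and images of lines -/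

theorem fderiv_pair_apply {u v : C2 → ℂ} {q : C2} (hu : AnalyticAt ℂ u q)
    (hv : AnalyticAt ℂ v q) (w : C2) :
    fderiv ℂ (fun r => (u r, v r)) q w
      = (w.1 * pdx u q + w.2 * pdy u q, w.1 * pdx v q + w.2 * pdy v q) := by
  rw [hu.differentiableAt.fderiv_prodMk hv.differentiableAt, ContinuousLinearMap.prod_apply,
    fderiv_apply_eq_pd, fderiv_apply_eq_pd]

theorem jac_ne_zero_iff {u v : C2 → ℂ} {q : C2} (hu : AnalyticAt ℂ u q)
    (hv : AnalyticAt ℂ v q) :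
    jac u v q ≠ 0 ↔ (fderiv ℂ (fun r => (u r, v r)) q).IsInvertible := by
  constructor
  · intro hJ
    have hinj : Function.Injective (fderiv ℂ (fun r => (u r, v r)) q) := by
      rw [injective_iff_map_eq_zero]
      intro w hw
      rw [fderiv_pair_apply hu hv, Prod.mk_eq_zero] at hw
      obtain ⟨h1, h2⟩ := linear_relation_eq_zero hJ hw.1 hw.2
      exact Prod.ext h1 h2
    refine ⟨(LinearEquiv.ofInjectiveEndo _ hinj).toContinuousLinearEquiv, ?_⟩
    ext1 <;> ext <;> rfl
  · intro hinv hJ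
    have hinj : Function.Injective (fderiv ℂ (fun r => (u r, v r)) q) := hinv.injective
    rw [injective_iff_map_eq_zero] at hinj
    have h1 := hinj (pdy v q, -pdx v q) (by
      rw [fderiv_pair_apply hu hv]
      unfold jac at hJ
      exact Prod.ext (by simp; linear_combination hJ) (by simp; ring))
    have h2 := hinj (pdy u q, -pdx u q) (by
      rw [fderiv_pair_apply hu hv]
      unfold jac at hJ
      exact Prod.ext (by simp; ring) (by simp; linear_combination -hJ))
    simp only [Prod.mk_eq_zero, neg_eq_zero] at h1 h2
    have h3 := hinj (1, 0) (by rw [fderiv_pair_apply hu hv]; simp [h1, h2])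
    simp at h3

theorem exists_analytic_local_inverse {φ : C2 → C2} {q : C2} (hφ : AnalyticAt ℂ φ q)
    (hinv : (fderiv ℂ φ q).IsInvertible) :
    ∃ ψ : C2 → C2, AnalyticAt ℂ ψ (φ q) ∧ ψ (φ q) = q ∧ (∀ᶠ r in 𝓝 q, ψ (φ r) = r) ∧
      ∀ᶠ r in 𝓝 (φ q), φ (ψ r) = r := by
  obtain ⟨e, he⟩ := hinv
  have h1 : ContDiffAt ℂ ⊤ φ q := hφ.contDiffAt
  have h2 : HasFDerivAt φ (e : C2 →L[ℂ] C2) q := by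
    rw [he]
    exact hφ.differentiableAt.hasFDerivAt
  have h3 : HasStrictFDerivAt φ (e : C2 →L[ℂ] C2) q := h1.hasStrictFDerivAt' h2 (by simp)
  exact ⟨h1.localInverse h2 (by simp), (h1.to_localInverse h2 (by simp)).analyticAt,
    h1.localInverse_apply_image h2 (by simp), h3.eventually_left_inverse,
    h3.eventually_right_inverse⟩

/-- Cramer's rule. -/
theorem exists_christoffel {u v : C2 → ℂ} {U : Set C2} (hu : AnalyticOnNhd ℂ u U)
    (hv : AnalyticOnNhd ℂ v U) (hJ : ∀ q ∈ U, jac u v q ≠ 0) :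
    ∃ A B C D E F : C2 → ℂ, (AnalyticOnNhd ℂ A U ∧ AnalyticOnNhd ℂ B U ∧ AnalyticOnNhd ℂ C U ∧
      AnalyticOnNhd ℂ D U ∧ AnalyticOnNhd ℂ E U ∧ AnalyticOnNhd ℂ F U) ∧
      ∀ q ∈ U, HasChristoffelAt A B C D E F u q ∧ HasChristoffelAt A B C D E F v q := by
  have hj (q) (hq : q ∈ U) : AnalyticAt ℂ (jac u v) q := by
    have h1 := hu q hq
    have h2 := hv q hq
    unfold jac
    fun_prop
  refine ⟨fun q => (pdx (pdx u) q * pdy v q - pdx (pdx v) q * pdy u q) / jac u v q,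
    fun q => (pdx u q * pdx (pdx v) q - pdx v q * pdx (pdx u) q) / jac u v q,
    fun q => (pdy (pdx u) q * pdy v q - pdy (pdx v) q * pdy u q) / jac u v q,
    fun q => (pdx u q * pdy (pdx v) q - pdx v q * pdy (pdx u) q) / jac u v q,
    fun q => (pdy (pdy u) q * pdy v q - pdy (pdy v) q * pdy u q) / jac u v q,
    fun q => (pdx u q * pdy (pdy v) q - pdx v q * pdy (pdy u) q) / jac u v q, ?_, ?_⟩
  · refine ⟨?_, ?_, ?_, ?_, ?_, ?_⟩
    all_goals
      intro q hq
      have h1 := hu q hq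
      have h2 := hv q hq
      exact AnalyticAt.fun_div (by fun_prop) (hj q hq) (hJ q hq)
  · intro q hq
    have h1 := hJ q hq
    refine ⟨⟨?_, ?_, ?_⟩, ?_, ?_, ?_⟩
    all_goals
      field_simp
      unfold jac
      ring

section Slope

variable {d : ℕ} {Ω : Set C2} (W : PlanarWeb d Ω) {i : Fin d} {lam : C2 → ℂ}

/-- The slope is not assumed analytic: it is the quotient of the components of an analytic vector
field spanning the foliation. -/
theorem PlanarWeb.analyticAt_slope (hΩ : IsOpen Ω)
    (hlam : ∀ q ∈ Ω, W.tangent i q = Submodule.span ℂ {((1 : ℂ), lam q)}) {q : C2} (hq : q ∈ Ω) :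
    AnalyticAt ℂ lam q := by
  obtain ⟨X, hX, h⟩ := W.foliation i q hq
  have key : ∀ᶠ r in 𝓝 q, (X r).1 ≠ 0 ∧ (X r).2 = (X r).1 * lam r := by
    filter_upwards [h, hΩ.mem_nhds hq] with r hr hrΩ
    have hmem : X r ∈ Submodule.span ℂ {((1 : ℂ), lam r)} := by
      rw [← hlam r hrΩ, hr.2]
      exact Submodule.mem_span_singleton_self _
    obtain ⟨k, hk⟩ := Submodule.mem_span_singleton.1 hmem
    have hne := hr.1
    rw [← hk] at hne ⊢
    have hk0 : k ≠ 0 := by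
      rintro rfl
      simp at hne
    simpa using hk0
  have h1 : AnalyticAt ℂ (fun r => (X r).2 / (X r).1) q :=
    (analyticAt_snd.comp hX).fun_div (analyticAt_fst.comp hX) key.self_of_nhds.1
  refine h1.congr ?_
  filter_upwards [key] with r hr
  rw [hr.2, mul_div_cancel_left₀ _ hr.1]

theorem hasDerivAt_line (r v : C2) (t : ℂ) : HasDerivAt (fun t : ℂ => r + t • v) v t := by
  simpa using ((hasDerivAt_id t).smul_const v).const_add r

theorem IsLeafCurveAt.line {T : C2 → Submodule ℂ C2} {r v : C2}
    (h : IsLeafCurveAt T (fun t : ℂ => r + t • v) 0) :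
    v ≠ 0 ∧ ∀ᶠ t in 𝓝 (0 : ℂ), v ∈ T (r + t • v) := by
  have h1 : ∀ᶠ t in 𝓝 (0 : ℂ), v ∈ T (r + t • v) ∧ v ≠ 0 := by
    filter_upwards [h] with t ⟨w, hw, hw0, hd⟩
    rw [hd.unique (hasDerivAt_line r v t)] at hw hw0
    exact ⟨hw, hw0⟩
  exact ⟨h1.self_of_nhds.2, h1.mono fun t ht => ht.1⟩

theorem tendsto_line (r v : C2) : Filter.Tendsto (fun t : ℂ => r + t • v) (𝓝 0) (𝓝 r) := by
  simpa using (hasDerivAt_line r v 0).continuousAt.tendsto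

theorem PlanarWeb.IsLinear.eventually_slope_eq (hW : W.IsLinear) (hΩ : IsOpen Ω)
    (hlam : ∀ q ∈ Ω, W.tangent i q = Submodule.span ℂ {((1 : ℂ), lam q)}) {q : C2} (hq : q ∈ Ω) :
    ∀ᶠ t in 𝓝 (0 : ℂ), lam (q + t • ((1 : ℂ), lam q)) = lam q := by
  obtain ⟨v, hv⟩ := hW i q hq
  obtain ⟨hv0, hv⟩ := hv.line
  have key : ∀ᶠ t in 𝓝 (0 : ℂ), v.2 = v.1 * lam (q + t • v) := by
    filter_upwards [hv, (tendsto_line q v).eventually (hΩ.mem_nhds hq)] with t ht htΩ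
    rw [hlam _ htΩ] at ht
    obtain ⟨k, hk⟩ := Submodule.mem_span_singleton.1 ht
    rw [← congrArg Prod.fst hk, ← congrArg Prod.snd hk]
    simp
  have h0 := key.self_of_nhds
  simp only [zero_smul, add_zero] at h0
  have hv1 : v.1 ≠ 0 := fun h => hv0 (Prod.ext h (by rw [h0, h, zero_mul]; rfl))
  have hvs : v = v.1 • ((1 : ℂ), lam q) := by
    ext <;> simp [h0]
  have ht : Filter.Tendsto (fun t : ℂ => t / v.1) (𝓝 0) (𝓝 0) := by
    have : ContinuousAt (fun t : ℂ => t / v.1) 0 := by fun_prop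
    simpa using this.tendsto
  filter_upwards [ht.eventually key] with t ht
  have e : (t / v.1) • v = t • ((1 : ℂ), lam q) := by
    conv_lhs => rw [hvs]
    rw [smul_smul, ← hvs, div_mul_cancel₀ _ hv1]
  rw [e, h0] at ht
  exact (mul_left_cancel₀ hv1 ht).symm

theorem pdx_add_slope_mul_pdy {q : C2} (ha : AnalyticAt ℂ lam q)
    (h : ∀ᶠ t in 𝓝 (0 : ℂ), lam (q + t • ((1 : ℂ), lam q)) = lam q) :
    pdx lam q + lam q * pdy lam q = 0 := by
  have h1 : HasDerivAt (fun t : ℂ => lam (q + t • ((1 : ℂ), lam q)))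
      (fderiv ℂ lam q (1, lam q)) 0 :=
    HasFDerivAt.comp_hasDerivAt (f := fun t : ℂ => q + t • ((1 : ℂ), lam q)) 0
      (by simpa using ha.differentiableAt.hasFDerivAt) (hasDerivAt_line _ _ _)
  have h2 := h1.unique ((hasDerivAt_const (0 : ℂ) (lam q)).congr_of_eventuallyEq h)
  rw [fderiv_apply_eq_pd] at h2
  simpa using h2

end Slope

theorem Submodule.map_span_singleton_clm {φ : C2 →L[ℂ] C2} (w : C2) :
    (Submodule.span ℂ {w}).map φ.toLinearMap = Submodule.span ℂ {φ w} := by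
  rw [Submodule.map_span, Set.image_singleton]
  rfl

/-- If the image of the direction field `(1, λ)` is tangent to a line through the image of `q`,
then pulling this line back and differentiating at `q` gives the cubic relation for `λ q`. -/
theorem christoffel_relation_of_linear_image {A B C D E F u v lam : C2 → ℂ} {q : C2}
    (hu : AnalyticAt ℂ u q) (hv : AnalyticAt ℂ v q) (hlam : AnalyticAt ℂ lam q)
    (hJ : jac u v q ≠ 0) (hcu : HasChristoffelAt A B C D E F u q)
    (hcv : HasChristoffelAt A B C D E F v q) (hconst : pdx lam q + lam q * pdy lam q = 0)
    {T : C2 → Submodule ℂ C2} {w : C2}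
    (hT : ∀ᶠ r in 𝓝 q, T (u r, v r)
      = Submodule.span ℂ {fderiv ℂ (fun r => (u r, v r)) r (1, lam r)})
    (hleaf : IsLeafCurveAt T (fun t : ℂ => (u q, v q) + t • w) 0) :
    lam q * (A q + 2 * lam q * C q + lam q ^ 2 * E q)
      = B q + 2 * lam q * D q + lam q ^ 2 * F q := by
  obtain ⟨hw0, hw⟩ := hleaf.line
  set φ : C2 → C2 := fun r => (u r, v r) with hφ
  have hφa : AnalyticAt ℂ φ q := hu.prod hv
  obtain ⟨ψ, hψ, hψq, -, hφψ⟩ := exists_analytic_local_inverse hφa ((jac_ne_zero_iff hu hv).1 hJ)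
  set y₁ : C2 → ℂ := fun r => pdx u r + lam r * pdy u r with hy₁
  set y₂ : C2 → ℂ := fun r => pdx v r + lam r * pdy v r with hy₂
  have hY : ∀ᶠ r in 𝓝 q, fderiv ℂ φ r (1, lam r) = (y₁ r, y₂ r) := by
    filter_upwards [hu.eventually_analyticAt, hv.eventually_analyticAt] with r h1 h2
    rw [hφ, fderiv_pair_apply h1 h2]
    simp [hy₁, hy₂]
  set γ : ℂ → C2 := fun t => φ q + t • w with hγ
  have htγ : Filter.Tendsto γ (𝓝 0) (𝓝 (φ q)) := tendsto_line _ _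
  have htψ : Filter.Tendsto (fun t => ψ (γ t)) (𝓝 0) (𝓝 q) := by
    have := hψ.continuousAt.tendsto
    rw [hψq] at this
    exact this.comp htγ
  -- the pulled back direction field is proportional to `w` along the line
  have hpar : ∀ᶠ t in 𝓝 (0 : ℂ), ∃ k : ℂ, w = k • (y₁ (ψ (γ t)), y₂ (ψ (γ t))) := by
    filter_upwards [hw, htψ.eventually hT, htψ.eventually hY, htγ.eventually hφψ]
      with t h1 h2 h3 h4
    have h5 : w ∈ T (φ (ψ (γ t))) := by rw [h4]; exact h1
    rw [show φ (ψ (γ t)) = (u (ψ (γ t)), v (ψ (γ t))) from rfl, h2, h3] at h5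
    obtain ⟨k, hk⟩ := Submodule.mem_span_singleton.1 h5
    exact ⟨k, hk.symm⟩
  obtain ⟨k, hk⟩ := hpar.self_of_nhds
  have hγ0 : γ 0 = φ q := by simp [hγ]
  rw [hγ0, hψq] at hk
  have hk0 : k ≠ 0 := by
    rintro rfl
    exact hw0 (by simpa using hk)
  set h : C2 → ℂ := fun r => y₁ r * w.2 - y₂ r * w.1 with hh
  have hy₁a : AnalyticAt ℂ y₁ q := by fun_prop
  have hy₂a : AnalyticAt ℂ y₂ q := by fun_prop
  have hha : AnalyticAt ℂ h q := by fun_prop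
  have hh0 : ∀ᶠ t in 𝓝 (0 : ℂ), h (ψ (γ t)) = 0 := by
    filter_upwards [hpar] with t ⟨k, hk⟩
    simp only [hh]
    rw [congrArg Prod.fst hk, congrArg Prod.snd hk]
    simp
    ring
  -- the velocity of the pulled back line is `k • (1, λ)`
  have hvel : HasDerivAt (fun t => ψ (γ t)) (k • ((1 : ℂ), lam q)) 0 := by
    have d1 : HasDerivAt (fun t => ψ (γ t)) (fderiv ℂ ψ (φ q) w) 0 :=
      HasFDerivAt.comp_hasDerivAt (f := γ) 0
        (by rw [hγ0]; exact hψ.differentiableAt.hasFDerivAt) (hasDerivAt_line _ _ _)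
    have d2 : HasDerivAt (fun t => φ (ψ (γ t))) (fderiv ℂ φ q (fderiv ℂ ψ (φ q) w)) 0 :=
      HasFDerivAt.comp_hasDerivAt (f := fun t => ψ (γ t)) 0
        (by rw [hγ0, hψq]; exact hφa.differentiableAt.hasFDerivAt) d1
    have d3 : HasDerivAt (fun t => φ (ψ (γ t))) w 0 :=
      (hasDerivAt_line (φ q) w 0).congr_of_eventuallyEq (htγ.eventually hφψ)
    have d4 : fderiv ℂ φ q (fderiv ℂ ψ (φ q) w) = fderiv ℂ φ q (k • ((1 : ℂ), lam q)) := by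
      rw [d2.unique d3, map_smul, hY.self_of_nhds, hk]
    rwa [((jac_ne_zero_iff hu hv).1 hJ).injective d4] at d1
  have hder : fderiv ℂ h q (k • ((1 : ℂ), lam q)) = 0 := by
    have d1 : HasDerivAt (fun t => h (ψ (γ t))) (fderiv ℂ h q (k • ((1 : ℂ), lam q))) 0 :=
      HasFDerivAt.comp_hasDerivAt (f := fun t => ψ (γ t)) 0
        (by rw [hγ0, hψq]; exact hha.differentiableAt.hasFDerivAt) hvel
    exact d1.unique ((hasDerivAt_const (0 : ℂ) (0 : ℂ)).congr_of_eventuallyEq hh0)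
  rw [map_smul, smul_eq_mul, mul_eq_zero, or_iff_right hk0, fderiv_apply_eq_pd] at hder
  have w1 : w.1 = k * (pdx u q + lam q * pdy u q) := congrArg Prod.fst hk
  have w2 : w.2 = k * (pdx v q + lam q * pdy v q) := congrArg Prod.snd hk
  simp (disch := fun_prop) only [hh, hy₁, hy₂, pdx_sub, pdx_mul, pdx_add, pdy_sub, pdy_mul, pdy_add,
    pdx_const, pdy_const, pdx_pdy_comm hu, pdx_pdy_comm hv, hcu.1, hcu.2.1, hcu.2.2, hcv.1,
    hcv.2.1, hcv.2.2, w1, w2] at hder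
  have hprod : k * jac u v q * (lam q * (A q + 2 * lam q * C q + lam q ^ 2 * E q)
      - (B q + 2 * lam q * D q + lam q ^ 2 * F q)) = 0 := by
    unfold jac
    linear_combination hder + k * (pdx u q * pdy v q - pdx v q * pdy u q) * hconst
  exact sub_eq_zero.1 ((mul_eq_zero.1 hprod).resolve_left (mul_ne_zero hk0 hJ))

theorem eq_smul_of_det_eq_zero {w v : C2} (ψ : C2 →L[ℂ] ℂ) (hψ : ψ v = 1)
    (h : w.1 * v.2 - w.2 * v.1 = 0) : w = ψ w • v := by
  have hv : v ≠ 0 := by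
    rintro rfl
    simp at hψ
  have : ∃ k : ℂ, w = k • v := by
    by_cases h1 : v.1 = 0
    · have h2 : v.2 ≠ 0 := fun h2 => hv (Prod.ext h1 h2)
      refine ⟨w.2 / v.2, Prod.ext ?_ ?_⟩
      · simp only [Prod.smul_fst, h1, smul_eq_mul, mul_zero]
        rw [h1, mul_zero, sub_zero] at h
        exact (mul_eq_zero.1 h).resolve_right h2
      · simp [h2]
    · refine ⟨w.1 / v.1, Prod.ext ?_ ?_⟩
      · simp [h1]
      · simp only [Prod.smul_snd, smul_eq_mul]
        field_simp
        linear_combination -h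
  obtain ⟨k, rfl⟩ := this
  rw [map_smul, hψ, smul_eq_mul, mul_one]

/-- By the cubic relation both components of the velocity of the image of the line through `q` with
slope `λ q` solve the same scalar linear equation of first order, so that their ratio is constant.
-/
theorem isLeafCurveAt_image_line {A B C D E F u v lam : C2 → ℂ} {q : C2}
    (hA : AnalyticAt ℂ A q) (hC : AnalyticAt ℂ C q) (hE : AnalyticAt ℂ E q)
    (hu : AnalyticAt ℂ u q) (hv : AnalyticAt ℂ v q) (hJ : jac u v q ≠ 0)
    (hcu : ∀ᶠ r in 𝓝 q, HasChristoffelAt A B C D E F u r)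
    (hcv : ∀ᶠ r in 𝓝 q, HasChristoffelAt A B C D E F v r)
    (hconst : ∀ᶠ t in 𝓝 (0 : ℂ), lam (q + t • ((1 : ℂ), lam q)) = lam q)
    (hrel : ∀ᶠ r in 𝓝 q, lam r * (A r + 2 * lam r * C r + lam r ^ 2 * E r)
      = B r + 2 * lam r * D r + lam r ^ 2 * F r)
    {T : C2 → Submodule ℂ C2}
    (hT : ∀ᶠ r in 𝓝 q, T (u r, v r)
      = Submodule.span ℂ {fderiv ℂ (fun r => (u r, v r)) r (1, lam r)}) :
    ∃ w : C2, IsLeafCurveAt T (fun t : ℂ => (u q, v q) + t • w) 0 := by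
  set m := lam q with hm
  set γ : ℂ → C2 := fun t => q + t • ((1 : ℂ), m) with hγ
  have hγ0 : γ 0 = q := by simp [hγ]
  have htγ : Filter.Tendsto γ (𝓝 0) (𝓝 q) := tendsto_line _ _
  have hγa : AnalyticAt ℂ γ 0 := by fun_prop
  have hcomp {f : C2 → ℂ} (hf : AnalyticAt ℂ f q) : AnalyticAt ℂ (fun t => f (γ t)) 0 :=
    AnalyticAt.comp (by rwa [hγ0]) hγa
  have hcompd {f : C2 → ℂ} {t : ℂ} (hf : AnalyticAt ℂ f (γ t)) :
      HasDerivAt (fun t => f (γ t)) (pdx f (γ t) + m * pdy f (γ t)) t := by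
    have := HasFDerivAt.comp_hasDerivAt (f := γ) t hf.differentiableAt.hasFDerivAt
      (hasDerivAt_line q ((1 : ℂ), m) t)
    rw [fderiv_apply_eq_pd, one_mul] at this
    exact this
  -- velocities of the two components of the image curve
  set z : (C2 → ℂ) → C2 → ℂ := fun s r => pdx s r + m * pdy s r with hz
  have hza {s : C2 → ℂ} {r : C2} (hs : AnalyticAt ℂ s r) : AnalyticAt ℂ (z s) r := by
    simp only [hz]
    fun_prop
  set α : C2 → ℂ := fun r => A r + 2 * m * C r + m ^ 2 * E r with hα
  have hαa : AnalyticAt ℂ α q := by fun_prop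
  have hode {s : C2 → ℂ} (hs : AnalyticAt ℂ s q)
      (hcs : ∀ᶠ r in 𝓝 q, HasChristoffelAt A B C D E F s r) :
      ∀ᶠ t in 𝓝 (0 : ℂ), HasDerivAt (fun t => z s (γ t)) (α (γ t) * z s (γ t)) t := by
    filter_upwards [htγ.eventually hcs, htγ.eventually hrel,
      htγ.eventually hs.eventually_analyticAt, hconst] with t h1 h2 h3 h4
    have h5 := hcompd (hza h3)
    obtain ⟨e1, e2, e3⟩ := h1
    rw [show lam (γ t) = m from h4] at h2
    have h6 : pdx (z s) (γ t) + m * pdy (z s) (γ t) = α (γ t) * z s (γ t) := by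
      simp (disch := fun_prop) only [hz, hα, pdx_add, pdx_mul, pdy_add, pdy_mul, pdx_const,
        pdy_const, pdx_pdy_comm h3, e1, e2, e3]
      linear_combination -pdy s (γ t) * h2
    rwa [h6] at h5
  have hou := hode hu hcu
  have hov := hode hv hcv
  set w : C2 := (z u q, z v q) with hw
  have hY : ∀ᶠ r in 𝓝 q, fderiv ℂ (fun r => (u r, v r)) r (1, m) = (z u r, z v r) := by
    filter_upwards [hu.eventually_analyticAt, hv.eventually_analyticAt] with r h1 h2
    rw [fderiv_pair_apply h1 h2]
    simp [hz]
  have hYne : ∀ᶠ r in 𝓝 q, (z u r, z v r) ≠ 0 := by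
    have h1 : AnalyticAt ℂ (jac u v) q := by unfold jac; fun_prop
    filter_upwards [h1.continuousAt.eventually_ne hJ, hu.eventually_analyticAt,
      hv.eventually_analyticAt] with r h2 h3 h4 h5
    simp only [hz, Prod.mk_eq_zero] at h5
    obtain ⟨h6, -⟩ := linear_relation_eq_zero (r := 1) (s := m) h2
      (by linear_combination h5.1) (by linear_combination h5.2)
    exact one_ne_zero h6
  have hw0 : w ≠ 0 := hYne.self_of_nhds
  -- the velocity stays proportional to `w`
  have hD : ∀ᶠ t in 𝓝 (0 : ℂ), z u (γ t) * w.2 - z v (γ t) * w.1 = 0 := by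
    refine eventually_eq_zero_of_linear_ode
      (B := fun t => α (γ t) • ContinuousLinearMap.id ℂ ℂ)
      (((hcomp (hza hu)).fun_mul analyticAt_const).fun_sub
        ((hcomp (hza hv)).fun_mul analyticAt_const))
      ((hcomp hαa).fun_smul analyticAt_const) (by rw [hγ0]; simp only [hw]; ring) ?_
    filter_upwards [hou, hov] with t h1 h2
    rw [((h1.mul_const w.2).fun_sub (h2.mul_const w.1)).deriv]
    simp
    ring
  -- hence the image curve stays on a line
  have hline : ∀ᶠ t in 𝓝 (0 : ℂ), (u (γ t) - u q) * w.2 - (v (γ t) - v q) * w.1 = 0 := by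
    refine eventually_eq_zero_of_linear_ode (B := fun _ => 0)
      ((((hcomp hu).fun_sub analyticAt_const).fun_mul analyticAt_const).fun_sub
        (((hcomp hv).fun_sub analyticAt_const).fun_mul analyticAt_const))
      analyticAt_const (by rw [hγ0]; ring) ?_
    filter_upwards [hD, htγ.eventually hu.eventually_analyticAt,
      htγ.eventually hv.eventually_analyticAt] with t h1 h2 h3
    rw [((((hcompd h2).sub_const _).mul_const w.2).fun_sub
      (((hcompd h3).sub_const _).mul_const w.1)).deriv]
    simpa using h1
  obtain ⟨ℓ, hℓ⟩ := SeparatingDual.exists_eq_one (R := ℂ) hw0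
  -- the parameter on the image line
  set f : ℂ → ℂ := fun t => ℓ ((u (γ t), v (γ t)) - (u q, v q)) with hf
  have hfa : AnalyticAt ℂ f 0 :=
    AnalyticAt.comp (f := fun t => (u (γ t), v (γ t)) - (u q, v q)) (ℓ.analyticAt _)
      (((hcomp hu).prod (hcomp hv)).fun_sub analyticAt_const)
  have hfd : HasDerivAt f 1 0 := by
    have hu0 := hcompd (t := 0) (by rwa [hγ0] : AnalyticAt ℂ u (γ 0))
    have hv0 := hcompd (t := 0) (by rwa [hγ0] : AnalyticAt ℂ v (γ 0))
    rw [hγ0] at hu0 hv0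
    have h1 := ℓ.hasFDerivAt.comp_hasDerivAt 0 ((hu0.prodMk hv0).sub_const (u q, v q))
    rw [← hℓ]
    exact h1
  have hf0 : f 0 = 0 := by simp only [hf]; rw [hγ0, sub_self, map_zero]
  have hmap : Filter.map f (𝓝 0) = 𝓝 0 := by
    have h1 : HasStrictDerivAt f 1 0 := by
      have := hfa.hasStrictDerivAt
      rwa [hfd.deriv] at this
    rw [h1.map_nhds_eq one_ne_zero, hf0]
  refine ⟨w, ?_⟩
  unfold IsLeafCurveAt
  rw [← hmap, Filter.eventually_map]
  filter_upwards [hD, hline, htγ.eventually hT, htγ.eventually hY, htγ.eventually hYne, hconst]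
    with t h1 h2 h3 h4 h5 h6
  refine ⟨w, ?_, hw0, hasDerivAt_line _ _ _⟩
  have h7 : (u q, v q) + f t • w = (u (γ t), v (γ t)) := by
    have := eq_smul_of_det_eq_zero (w := (u (γ t), v (γ t)) - (u q, v q)) ℓ hℓ h2
    simp only [hf]
    rw [← this]
    abel
  have h8 := eq_smul_of_det_eq_zero (w := (z u (γ t), z v (γ t))) ℓ hℓ h1
  have h9 : ℓ (z u (γ t), z v (γ t)) ≠ 0 := fun h => h5 (by rw [h8, h, zero_smul])
  rw [h7, h3, show lam (γ t) = m from h6, h4, Submodule.mem_span_singleton]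
  refine ⟨(ℓ (z u (γ t), z v (γ t)))⁻¹, ?_⟩
  conv_lhs => rw [h8]
  rw [map_smul, hℓ, smul_eq_mul, mul_one, smul_smul, inv_mul_cancel₀ h9, one_smul]

/-! ### Morphisms of linear webs and the Tresse system -/

theorem HasChristoffelAt.congr_coeff {A B C D E F A' B' C' D' E' F' s : C2 → ℂ} {q : C2}
    (h : HasChristoffelAt A B C D E F s q) (hA : A q = A' q) (hB : B q = B' q) (hC : C q = C' q)
    (hD : D q = D' q) (hE : E q = E' q) (hF : F q = F' q) :
    HasChristoffelAt A' B' C' D' E' F' s q := by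
  unfold HasChristoffelAt at h ⊢
  rwa [← hA, ← hB, ← hC, ← hD, ← hE, ← hF]

theorem exists_tresse_of_morphism {d : ℕ} {Ω : Set C2} (hΩ : IsOpen Ω) (W : PlanarWeb d Ω)
    (hW : W.IsLinear) {lam : Fin d → C2 → ℂ}
    (hlam : ∀ i, ∀ q ∈ Ω, W.tangent i q = Submodule.span ℂ {((1 : ℂ), lam i q)})
    {U : Set C2} (hU : IsOpen U) (hUc : IsConnected U) (hUΩ : U ⊆ Ω) {φ : C2 → C2}
    (hφ : W.IsMorphismOn φ U) (hproj : ¬ IsProjectiveOn φ U) :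
    ∃ K L M N : C2 → ℂ,
      (AnalyticOnNhd ℂ K U ∧ AnalyticOnNhd ℂ L U ∧ AnalyticOnNhd ℂ M U ∧ AnalyticOnNhd ℂ N U) ∧
      TresseSystem K L M N U ∧
      (∃ q ∈ U, ¬ (K q = 0 ∧ L q = 0 ∧ M q = 0 ∧ N q = 0)) ∧
      ∀ i, ∀ q ∈ U,
        L q * lam i q ^ 3 - 3 * N q * lam i q ^ 2 + 3 * K q * lam i q - M q = 0 := by
  obtain ⟨hbi, W', hW', htan⟩ := hφ
  set u : C2 → ℂ := fun r => (φ r).1 with hu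
  set v : C2 → ℂ := fun r => (φ r).2 with hv
  have hφuv : φ = fun r => (u r, v r) := rfl
  have hua : AnalyticOnNhd ℂ u U := fun q hq => analyticAt_fst.comp (hbi.analytic q hq)
  have hva : AnalyticOnNhd ℂ v U := fun q hq => analyticAt_snd.comp (hbi.analytic q hq)
  have hJ : ∀ q ∈ U, jac u v q ≠ 0 := fun q hq =>
    (jac_ne_zero_iff (hua q hq) (hva q hq)).2 (hbi.invertible q hq)
  obtain ⟨A, B, C, D, E, F, ⟨hA, hB, hC, hD, hE, hF⟩, hchr⟩ := exists_christoffel hua hva hJ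
  have hnear {P : C2 → Prop} (h : ∀ r ∈ U, P r) {q : C2} (hq : q ∈ U) : ∀ᶠ r in 𝓝 q, P r :=
    Filter.eventually_of_mem (hU.mem_nhds hq) h
  have hflat : ∀ q ∈ U, FlatTorsionFreeAt A B C D E F q := fun q hq =>
    flatTorsionFreeAt_of_christoffel (hA q hq) (hB q hq) (hC q hq) (hD q hq) (hE q hq) (hF q hq)
      (hua q hq) (hva q hq) (hJ q hq) (hnear (fun r hr => (hchr r hr).1) hq)
      (hnear (fun r hr => (hchr r hr).2) hq)
  refine ⟨fun q => 3⁻¹ * (A q - 2 * D q), E, B, fun q => 3⁻¹ * (F q - 2 * C q),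
    ⟨?_, hE, hB, ?_⟩, ?_, ?_, ?_⟩
  · intro q hq
    have h1 := hA q hq
    have h2 := hD q hq
    fun_prop
  · intro q hq
    have h1 := hF q hq
    have h2 := hC q hq
    fun_prop
  · exact fun q hq => tresse_of_flat (hA q hq) (hB q hq) (hC q hq) (hD q hq) (hE q hq) (hF q hq)
      (hnear hflat hq) q rfl
  · by_contra! hzero
    have h0 : ∀ q ∈ U, A q = 2 * D q ∧ B q = 0 ∧ E q = 0 ∧ F q = 2 * C q := by
      intro q hq
      obtain ⟨h1, h2, h3, h4⟩ := hzero q hq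
      exact ⟨by linear_combination 3 * h1, h3, h2, by linear_combination 3 * h4⟩
    have hcu : ∀ q ∈ U, HasChristoffelAt (fun q => 2 * D q) (fun _ => 0) C D (fun _ => 0)
        (fun q => 2 * C q) u q := fun q hq => (hchr q hq).1.congr_coeff (h0 q hq).1
      (h0 q hq).2.1 rfl rfl (h0 q hq).2.2.1 (h0 q hq).2.2.2
    have hcv : ∀ q ∈ U, HasChristoffelAt (fun q => 2 * D q) (fun _ => 0) C D (fun _ => 0)
        (fun q => 2 * C q) v q := fun q hq => (hchr q hq).2.congr_coeff (h0 q hq).1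
      (h0 q hq).2.1 rfl rfl (h0 q hq).2.2.1 (h0 q hq).2.2.2
    obtain ⟨p, hp⟩ := hUc.nonempty
    refine hproj (isProjectiveOn_of_christoffel hUc.isPreconnected hU hp (fun _ => rfl) hua hva
      (hJ p hp) (hC p hp) (hD p hp) (hnear (fun q hq => ?_) hp) (hnear hcu hp) (hnear hcv hp))
    have h1 := hC q hq
    have h2 := hD q hq
    exact flatTorsionFreeAt_of_christoffel (by fun_prop) analyticAt_const h1 h2 analyticAt_const
      (by fun_prop) (hua q hq) (hva q hq) (hJ q hq) (hnear hcu hq) (hnear hcv hq)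
  · intro i q hq
    obtain ⟨w, hw⟩ := hW' i (φ q) ⟨q, hq, rfl⟩
    have hla := W.analyticAt_slope hΩ (hlam i) (hUΩ hq)
    have key := christoffel_relation_of_linear_image (hua q hq) (hva q hq) hla (hJ q hq)
      (hchr q hq).1 (hchr q hq).2
      (pdx_add_slope_mul_pdy hla (hW.eventually_slope_eq W hΩ (hlam i) (hUΩ hq)))
      (hnear (fun r hr => (by
        rw [← hφuv]
        change W'.tangent i (φ r) = _
        rw [htan i r hr, hlam i r (hUΩ hr), Submodule.map_span_singleton_clm])) hq) hw
    linear_combination key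

theorem exists_morphism_of_tresse {d : ℕ} {Ω : Set C2} (hΩ : IsOpen Ω) (W : PlanarWeb d Ω)
    (hW : W.IsLinear) {lam : Fin d → C2 → ℂ}
    (hlam : ∀ i, ∀ q ∈ Ω, W.tangent i q = Submodule.span ℂ {((1 : ℂ), lam i q)})
    {U : Set C2} (hU : IsOpen U) (hUc : IsConnected U) (hUΩ : U ⊆ Ω) {p : C2} (hp : p ∈ U)
    {K L M N : C2 → ℂ} (hK : AnalyticOnNhd ℂ K U) (hL : AnalyticOnNhd ℂ L U)
    (hM : AnalyticOnNhd ℂ M U) (hN : AnalyticOnNhd ℂ N U) (hT : TresseSystem K L M N U)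
    (hne : ∃ q ∈ U, ¬ (K q = 0 ∧ L q = 0 ∧ M q = 0 ∧ N q = 0))
    (hrel : ∀ i, ∀ q ∈ U,
      L q * lam i q ^ 3 - 3 * N q * lam i q ^ 2 + 3 * K q * lam i q - M q = 0) :
    ∃ V : Set C2, IsOpen V ∧ IsConnected V ∧ p ∈ V ∧ V ⊆ Ω ∧
      ∃ φ : C2 → C2, W.IsMorphismOn φ V ∧ ¬ IsProjectiveOn φ V := by
  obtain ⟨u, v, a, b, hu, hv, ha, hb, hJ, hchr⟩ := exists_flattening
    (hK p hp) (hL p hp) (hM p hp) (hN p hp)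
    (Filter.eventually_of_mem (hU.mem_nhds hp) fun q hq r hr => by
      rw [Set.mem_singleton_iff.1 hr]; exact hT q hq)
  set φ : C2 → C2 := fun r => (u r, v r) with hφ
  have hφa : AnalyticAt ℂ φ p := hu.prod hv
  obtain ⟨ψ, -, -, hψ, -⟩ := exists_analytic_local_inverse hφa ((jac_ne_zero_iff hu hv).1 hJ)
  have hJa : AnalyticAt ℂ (jac u v) p := by unfold jac; fun_prop
  obtain ⟨ε, hε, hball⟩ := Metric.eventually_nhds_iff_ball.1
    ((hU.eventually_mem hp).and (hu.eventually_analyticAt.and (hv.eventually_analyticAt.and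
      (ha.eventually_analyticAt.and (hb.eventually_analyticAt.and
        ((hJa.continuousAt.eventually_ne hJ).and (hψ.and hchr)))))))
  set V := Metric.ball p ε with hV
  have hVo : IsOpen V := Metric.isOpen_ball
  have hpV : p ∈ V := Metric.mem_ball_self hε
  have hVU : V ⊆ U := fun q hq => (hball q hq).1
  have hVc : IsConnected V := (convex_ball p ε).isConnected ⟨p, hpV⟩
  have hnear {P : C2 → Prop} (h : ∀ r ∈ V, P r) {q : C2} (hq : q ∈ V) : ∀ᶠ r in 𝓝 q, P r :=
    Filter.eventually_of_mem (hVo.mem_nhds hq) h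
  have hua (q) (hq : q ∈ V) : AnalyticAt ℂ u q := (hball q hq).2.1
  have hva (q) (hq : q ∈ V) : AnalyticAt ℂ v q := (hball q hq).2.2.1
  have haa (q) (hq : q ∈ V) : AnalyticAt ℂ a q := (hball q hq).2.2.2.1
  have hba (q) (hq : q ∈ V) : AnalyticAt ℂ b q := (hball q hq).2.2.2.2.1
  have hJV (q) (hq : q ∈ V) : jac u v q ≠ 0 := (hball q hq).2.2.2.2.2.1
  have hcu (q) (hq : q ∈ V) := (hball q hq).2.2.2.2.2.2.2 u (by simp)
  have hcv (q) (hq : q ∈ V) := (hball q hq).2.2.2.2.2.2.2 v (by simp)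
  have hinj : Set.InjOn φ V := by
    intro q hq r hr h
    rw [← (hball q hq).2.2.2.2.2.2.1, h, (hball r hr).2.2.2.2.2.2.1]
  have hinv (q) (hq : q ∈ V) : (fderiv ℂ φ q).IsInvertible :=
    (jac_ne_zero_iff (hua q hq) (hva q hq)).1 (hJV q hq)
  -- the image web
  set T : Fin d → C2 → Submodule ℂ C2 := fun i r =>
    (W.tangent i (Function.invFunOn φ V r)).map
      (fderiv ℂ φ (Function.invFunOn φ V r)).toLinearMap with hTdef
  have hTφ (i) (q) (hq : q ∈ V) :
      T i (φ q) = (W.tangent i q).map (fderiv ℂ φ q).toLinearMap := by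
    simp only [hTdef, hinj.leftInvOn_invFunOn hq]
  have hfol (i) : IsFoliationOn (T i) (φ '' V) := by
    rintro _ ⟨q, hq, rfl⟩
    obtain ⟨X, hX, hXT⟩ := W.foliation i q (hUΩ (hVU hq))
    obtain ⟨χ, hχ, hχq, -, hφχ⟩ :=
      exists_analytic_local_inverse ((hua q hq).prod (hva q hq)) (hinv q hq)
    have htχ : Filter.Tendsto χ (𝓝 (φ q)) (𝓝 q) := by
      have := hχ.continuousAt.tendsto
      rwa [hχq] at this
    refine ⟨fun r => fderiv ℂ φ (χ r) (X (χ r)), analyticAt_clm_apply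
      (AnalyticAt.comp (f := χ) (g := fderiv ℂ φ) ?_ hχ) (AnalyticAt.comp ?_ hχ), ?_⟩
    · rw [hχq]; exact ((hua q hq).prod (hva q hq)).fderiv
    · rwa [hχq]
    · filter_upwards [htχ.eventually hXT, htχ.eventually (hVo.mem_nhds hq), hφχ]
        with r h1 h2 h3
      refine ⟨fun h => h1.1 ((hinv _ h2).injective (h.trans (map_zero _).symm)), ?_⟩
      have h4 := hTφ i (χ r) h2
      rw [h1.2, Submodule.map_span_singleton_clm] at h4
      rw [← h4]
      exact congrArg (T i) h3.symm
  let W' : PlanarWeb d (φ '' V) :=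
    { tangent := T
      foliation := hfol
      transverse := by
        rintro _ ⟨q, hq, rfl⟩ i j hij h
        rw [hTφ i q hq, hTφ j q hq] at h
        exact W.transverse q (hUΩ (hVU hq)) i j hij
          (Submodule.map_injective_of_injective (hinv q hq).injective h) }
  have hlin : W'.IsLinear := by
    rintro i _ ⟨q, hq, rfl⟩
    have h1 := haa q hq
    have h2 := hba q hq
    have h3 := hK q (hVU hq)
    have h4 := hN q (hVU hq)
    exact isLeafCurveAt_image_line (by fun_prop) (by fun_prop) (hL q (hVU hq)) (hua q hq) (hva q hq)
      (hJV q hq) (hnear hcu hq) (hnear hcv hq)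
      (hW.eventually_slope_eq W hΩ (hlam i) (hUΩ (hVU hq)))
      (hnear (fun r hr => by linear_combination hrel i r (hVU hr)) hq)
      (hnear (fun r hr => by
        change T i (φ r) = _
        rw [hTφ i r hr, hlam i r (hUΩ (hVU hr)), Submodule.map_span_singleton_clm]) hq)
  refine ⟨V, hVo, hVc, hpV, hVU.trans hUΩ, φ,
    ⟨⟨fun q hq => (hua q hq).prod (hva q hq), hinj, hinv⟩, W', hlin, hTφ⟩, fun hproj => ?_⟩
  -- a projective `φ` would force `K = L = M = N = 0` on `V`, hence on `U`
  have hzero (q) (hq : q ∈ V) : K q = 0 ∧ L q = 0 ∧ M q = 0 ∧ N q = 0 := by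
    obtain ⟨h1, h2, h3, h4⟩ := eq_of_isProjectiveOn hVo hq (fun _ => rfl) (hua q hq) (hva q hq)
      (hJV q hq) (hcu q hq) (hcv q hq) hproj
    exact ⟨by linear_combination (1 / 3) * h1, h3, h2, by linear_combination (1 / 3) * h4⟩
  have hext {f : C2 → ℂ} (hf : AnalyticOnNhd ℂ f U) (h : ∀ q ∈ V, f q = 0) :
      ∀ q ∈ U, f q = 0 := fun q hq =>
    hf.eqOn_zero_of_preconnected_of_eventuallyEq_zero hUc.isPreconnected hp (hnear h hpV) hq
  obtain ⟨q, hq, hqne⟩ := hne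
  exact hqne ⟨hext hK (fun r hr => (hzero r hr).1) q hq,
    hext hL (fun r hr => (hzero r hr).2.1) q hq,
    hext hM (fun r hr => (hzero r hr).2.2.1) q hq, hext hN (fun r hr => (hzero r hr).2.2.2) q hq⟩

theorem proposition1 (Ω : Set C2) (hΩ : IsOpen Ω) (W : PlanarWeb 3 Ω) (hW : W.IsLinear)
    (lam : Fin 3 → C2 → ℂ)
    (hlam : ∀ i, ∀ q ∈ Ω, W.tangent i q = Submodule.span ℂ {((1 : ℂ), lam i q)})
    (p : C2) (hp : p ∈ Ω) :
    (∃ U : Set C2, IsOpen U ∧ IsConnected U ∧ p ∈ U ∧ U ⊆ Ω ∧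
      ∃ φ : C2 → C2, W.IsMorphismOn φ U ∧ ¬ IsProjectiveOn φ U) ↔
    (∃ U : Set C2, IsOpen U ∧ IsConnected U ∧ p ∈ U ∧ U ⊆ Ω ∧
      ∃ K L M N : C2 → ℂ,
        (AnalyticOnNhd ℂ K U ∧ AnalyticOnNhd ℂ L U ∧ AnalyticOnNhd ℂ M U ∧
          AnalyticOnNhd ℂ N U) ∧
        TresseSystem K L M N U ∧
        (∃ q ∈ U, ¬ (K q = 0 ∧ L q = 0 ∧ M q = 0 ∧ N q = 0)) ∧
        ∀ i, ∀ q ∈ U,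
          L q * lam i q ^ 3 - 3 * N q * lam i q ^ 2 + 3 * K q * lam i q - M q = 0) := by
  constructor
  · rintro ⟨U, hU, hUc, hpU, hUΩ, φ, hφ, hproj⟩
    exact ⟨U, hU, hUc, hpU, hUΩ, exists_tresse_of_morphism hΩ W hW hlam hU hUc hUΩ hφ hproj⟩
  · rintro ⟨U, hU, hUc, hpU, hUΩ, K, L, M, N, ⟨hK, hL, hM, hN⟩, hT, hne, hrel⟩
    exact exists_morphism_of_tresse hΩ W hW hlam hU hUc hUΩ hpU hK hL hM hN hT hne hrel
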